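/- Let $n$ be a prime with $n\equiv 5 \pmod 8$, let $q$ be a power of a prime $p$ with $\frac{n-1}{4}\equiv 0\pmod p$, and write $n=u^2+4v^2$ with integers $u\equiv 1\pmod 4$ and $v$. Fix a primitive root $\alpha$ modulo $n$ and let $C_i=\alpha^i\langle\alpha^4\rangle\subset(\mathbb Z/n)^*$ ($0\le i\le 3$) be the cyclotomic classes of order four. Assume $q \bmod n\in C_0$. Let $\eta$ be a primitive $n$-th root of unity in an extension field of $\mathrm{GF}(q)$, put $$\Omega_i(x)=\prod_{j\in C_i}(x-\eta^j),\qquad \eta_i=\sum_{j\in C_i}\eta^j ,$$ and suppose that $\eta$ is chosen such that $\eta_0+\eta_2=0$. For $\rho\in\{0,1\}$ let $\lambda^\infty=(\lambda_i)_{i\ge0}$ be the sequence over $\mathrm{GF}(q)$ of period $n$ with $\lambda_i=1$ if $i\bmod n\in C_1\cup C_2\cup C_3$, $\lambda_i=0$ if $i\bmod n\in C_0$, and $\lambda_i=\rho$ if $n\mid i$. A characteristic polynomial of $\lambda^\infty$ is a polynomial $c(x)=\sum_j c_jx^j$ over $\mathrm{GF}(q)$ with $c_0=1$ and $\sum_{j=0}^{\deg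 c}c_j\lambda_{i-j}=0$ for all $i\ge \deg c$. The minimal polynomial of $\lambda^\infty$ is the (unique) characteristic polynomial of smallest degree; formulas for $m_\lambda(x)$ below give it in monic form, that is, up to the nonzero scalar that makes the constant term $1$. The linear span $\mathbb L_\lambda$ is the smallest $\ell$ for which there are $c_0=1,c_1,\dots,c_\ell\in\mathrm{GF}(q)$ with $\sum_{j=0}^{\ell}c_j\lambda_{i-j}=0$ for all $i\ge\ell$. Let $\mathcal C_\lambda$ be the cyclic code of length $n$ over $\mathrm{GF}(q)$ generated by $(x^n-1)/\gcd(x^n-1,\Lambda(x))$, where $\Lambda(x)=\sum_{i=0}^{n-1}\lambda_ix^i$. Let $d$ denote its minimum nonzero Hamming weight and $d_{odd}$ the minimum weight of its codewords $(c_i)$ with $\sum_i c_i\ne0$. A cyclic code of length $n$ over $\mathrm{GF}(q)$ is called duadic if there are a partition $S\cup T$ of $(\mathbb Z/n)\setminus\{0\}$ into two sets closed under multiplication by $q$ and a unit $b$ of $\mathbb Z/n$ with $bS=T$, $bT=S$, such that its generator polynomial is $\prod_{i\in S}(x-\eta^i)$ or $(x-1)\prod_{i\in S}(x-\eta^i)$.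 Put $r=q^{(n-1)/4}$, $N=\frac{r-1}{n}$, $N_1=\frac{N}{q-1}$, and $$\mathcal B_1=\left\lceil\frac{(q-1)\left(r-\lfloor(N_1-1)\sqrt r\rfloor\right)}{qN}\right\rceil,\qquad \mathcal B_2=\frac{(q-1)(r-1)-1}{qN}-\frac{q-1}{q}\cdot\frac{(N-1)\sqrt r}{N},$$ and let $A=\frac{3n-1+2u}{16}$, $B=\frac{3n+3-2u}{16}$ (these are integers). In every case below, the polynomial $m_\lambda(x)$ has coefficients in $\mathrm{GF}(q)$, $\mathcal C_\lambda$ has generator polynomial $m_\lambda(x)$ and dimension $n-\mathbb L_\lambda$, and the listed subcases are exhaustive. 1. If $A\equiv 0$ and $B\equiv0\pmod p$, then $\eta_1\in\{0,-1\}$ and - $\rho=0$: $m_\lambda=\frac{x^n-1}{(x-1)\Omega_3}$ if $\eta_1=0$, $m_\lambda=\frac{x^n-1}{(x-1)\Omega_1}$ if $\eta_1=-1$, and $\mathbb L_\lambda=n-\frac{n+3}4$; moreover $d\ge\mathcal B_2$ if $\mathrm{ord}_n(q)=\frac{n-1}4$; - $\rho=1$: $m_\lambda=\frac{x^n-1}{\Omega_1\Omega_0\Omega_2}$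 if $\eta_1=0$, $m_\lambda=\frac{x^n-1}{\Omega_3\Omega_0\Omega_2}$ if $\eta_1=-1$, and $\mathbb L_\lambda=n-\frac{3n-3}4$. 2. If $A\equiv0$ and $B\not\equiv0\pmod p$, then - $\rho=0$: $m_\lambda=\frac{x^n-1}{x-1}$, $\mathbb L_\lambda=n-1$ and $d=n$; - $\rho=1$: $m_\lambda=\frac{x^n-1}{\Omega_0\Omega_2}$, $\mathbb L_\lambda=n-\frac{n-1}2$ and $d\ge\sqrt n$. 3. If $A\equiv p-1$ and $B\equiv0\pmod p$, then $\eta_0\in\{1,-1\}$, $\eta_1\in\{0,-1\}$ and - $\rho=0$: $m_\lambda=\frac{x^n-1}{(x-1)\Omega_i\Omega_j}$ with $i=3$ if $\eta_1=0$, $i=1$ if $\eta_1=-1$, $j=2$ if $\eta_0=1$, $j=0$ if $\eta_0=-1$; $\mathbb L_\lambda=n-\frac{n+1}2$; the code $\mathcal C_\lambda$ is duadic, and $d_{odd}\ge\sqrt n$; - $\rho=1$: $m_\lambda=\frac{x^n-1}{\Omega_1}$ if $\eta_1=0$, $m_\lambda=\frac{x^n-1}{\Omega_3}$ if $\eta_1=-1$,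 and $\mathbb L_\lambda=n-\frac{n-1}4$; moreover $d\ge\mathcal B_1$ if $\mathrm{ord}_n(q)=\frac{n-1}4$. 4. If $A\equiv p-1$ and $B\not\equiv0\pmod p$, then $\eta_0\in\{1,-1\}$ and - $\rho=0$: $m_\lambda=\frac{x^n-1}{(x-1)\Omega_2}$ if $\eta_0=1$, $m_\lambda=\frac{x^n-1}{(x-1)\Omega_0}$ if $\eta_0=-1$, and $\mathbb L_\lambda=n-\frac{n+3}4$; moreover $d\ge\mathcal B_2$ if $\mathrm{ord}_n(q)=\frac{n-1}4$; - $\rho=1$: $m_\lambda=x^n-1$ and $\mathbb L_\lambda=n$. 5. If $A\not\equiv0,p-1$ and $B\equiv0\pmod p$, then $\eta_1\in\{0,-1\}$ and - $\rho=0$: $m_\lambda=\frac{x^n-1}{(x-1)\Omega_3}$ if $\eta_1=0$, $m_\lambda=\frac{x^n-1}{(x-1)\Omega_1}$ if $\eta_1=-1$, and $\mathbb L_\lambda=n-\frac{n+3}4$; moreover $d\ge\mathcal B_2$ if $\mathrm{ord}_n(q)=\frac{n-1}4$; - $\rho=1$: $m_\lambda=\frac{x^n-1}{\Omega_1}$ if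 $\eta_1=0$, $m_\lambda=\frac{x^n-1}{\Omega_3}$ if $\eta_1=-1$, and $\mathbb L_\lambda=n-\frac{n-1}4$; moreover $d\ge\mathcal B_1$ if $\mathrm{ord}_n(q)=\frac{n-1}4$. 6. If $A\not\equiv0,p-1$ and $B\not\equiv0\pmod p$, then - $\rho=0$: $m_\lambda=\frac{x^n-1}{x-1}$, $\mathbb L_\lambda=n-1$ and $d=n$; - $\rho=1$: $m_\lambda=x^n-1$ and $\mathbb L_\lambda=n$. -/

import Mathlib

open Polynomial

noncomputable section

namespace CyclotomicCode

/-! ### Periodic sequences, their linear span and minimal polynomial -/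

section Sequences

variable {K : Type*} [Field K]

/-- The linear span of `s`: the smallest `ℓ` for which there are constants `c₀ = 1, c₁, …, c_ℓ`
with `c₀ sᵢ + c₁ sᵢ₋₁ + ⋯ + c_ℓ sᵢ₋ℓ = 0` for all `i ≥ ℓ`. (The value `ℓ = 0` is possible for
the zero sequence only.) -/
def linearSpan (s : ℕ → K) : ℕ :=
  sInf {ℓ : ℕ | ∃ c : ℕ → K, c 0 = 1 ∧
    ∀ i, ℓ ≤ i → ∑ j ∈ Finset.range (ℓ + 1), c j * s (i - j) = 0}

/-- `c` is a characteristic (feedback) polynomial of the sequence `s`. -/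
def IsCharacteristicPolynomial (s : ℕ → K) (c : K[X]) : Prop :=
  c.coeff 0 = 1 ∧
    ∀ i, c.natDegree ≤ i → ∑ j ∈ Finset.range (c.natDegree + 1), c.coeff j * s (i - j) = 0

/-- `c` is the characteristic polynomial of smallest degree of the sequence `s`
(in particular there is only one of that degree). -/
def IsMinimalPolynomial (s : ℕ → K) (c : K[X]) : Prop :=
  IsCharacteristicPolynomial s c ∧
    ∀ c' : K[X], IsCharacteristicPolynomial s c' → c' ≠ c → c.natDegree < c'.natDegree

/-- The polynomial `s₀ + s₁ x + ⋯ + sₙ₋₁ xⁿ⁻¹`. -/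
def seqPoly (n : ℕ) (s : ℕ → K) : K[X] :=
  ∑ i ∈ Finset.range n, C (s i) * X ^ i

end Sequences

/-! ### Cyclic codes -/

section Codes

variable {K : Type*} [Field K]

/-- The polynomial `c₀ + c₁ x + ⋯ + cₙ₋₁ xⁿ⁻¹` of a word `c`, as a linear map. -/
def wordPoly (n : ℕ) : (Fin n → K) →ₗ[K] K[X] :=
  ∑ i : Fin n, (monomial (i : ℕ)) ∘ₗ (LinearMap.proj i)

/-- The cyclic code of length `n` that corresponds to the ideal `(g)` of `K[x]/(xⁿ - 1)`. -/
def cyclicCode (n : ℕ) (g : K[X]) : Submodule K (Fin n → K) :=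
  ((Ideal.span {g, X ^ n - 1} : Ideal K[X]).restrictScalars K).comap (wordPoly n)

/-- `g` is the generator polynomial of the cyclic code `D` of length `n`. -/
def IsGeneratorPolynomial (n : ℕ) (D : Submodule K (Fin n → K)) (g : K[X]) : Prop :=
  g.Monic ∧ g ∣ X ^ n - 1 ∧ D = cyclicCode n g

open Classical in
/-- The code defined by the sequence `s` of period `n`: the cyclic code generated by
`(xⁿ - 1) / gcd(s₀ + s₁ x + ⋯ + sₙ₋₁ xⁿ⁻¹, xⁿ - 1)`. -/
def seqCode (n : ℕ) (s : ℕ → K) : Submodule K (Fin n → K) :=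
  cyclicCode n ((X ^ n - 1) / EuclideanDomain.gcd (seqPoly n s) (X ^ n - 1))

open Classical in
/-- The minimum nonzero Hamming weight of a (nonzero) code. -/
def minWeight {n : ℕ} (D : Submodule K (Fin n → K)) : ℕ :=
  sInf {w : ℕ | ∃ c ∈ D, c ≠ 0 ∧ hammingNorm c = w}

open Classical in
/-- The minimum Hamming weight of the odd-like codewords, i.e. those with `∑ cᵢ ≠ 0`. -/
def minOddWeight {n : ℕ} (D : Submodule K (Fin n → K)) : ℕ :=
  sInf {w : ℕ | ∃ c ∈ D, ∑ i, c i ≠ 0 ∧ hammingNorm c = w}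

/-- `D` is a duadic code of length `n` over `K`: there is a splitting `(S, T)` of `ℤ/n`, that is,
`S` and `T` are unions of `q`-cyclotomic cosets (`q = |K|`) that partition the nonzero residues
and are exchanged by a multiplier `b`, and the zeros of the generator polynomial of `D` are the
`ηⁱ` with `i ∈ S` or with `i ∈ {0} ∪ S`. Here `η` is a primitive `n`-th root of unity. -/
def IsDuadicCode {L : Type*} [Field L] [Algebra K L] [Fintype K] {n : ℕ} [NeZero n] (η : L)
    (D : Submodule K (Fin n → K)) : Prop :=
  ∃ (S T : Finset (ZMod n)) (b : (ZMod n)ˣ),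
    Disjoint S T ∧ S ∪ T = Finset.univ.erase 0 ∧
    (∀ x ∈ S, (Fintype.card K : ZMod n) * x ∈ S) ∧
    (∀ x ∈ T, (Fintype.card K : ZMod n) * x ∈ T) ∧
    (∀ x, x ∈ S ↔ (b : ZMod n) * x ∈ T) ∧ (∀ x, x ∈ T ↔ (b : ZMod n) * x ∈ S) ∧
    ∃ g : K[X], IsGeneratorPolynomial n D g ∧
      (g.map (algebraMap K L) = ∏ j ∈ S, (X - C (η ^ j.val)) ∨
       g.map (algebraMap K L) = (X - 1) * ∏ j ∈ S, (X - C (η ^ j.val)))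

/-- `f`, with coefficients in `K`, is (up to the nonzero scalar that makes the constant term `1`)
the minimal polynomial of the sequence `s`, whose linear span is `ℓ`; and the code defined by `s`
has generator polynomial `f` and dimension `n - ℓ`. -/
def SeqCodeData {L : Type*} [Field L] [Algebra K L] (n : ℕ) (s : ℕ → K) (f : L[X]) (ℓ : ℕ) :
    Prop :=
  linearSpan s = ℓ ∧
  ∃ m : K[X], m.map (algebraMap K L) = f ∧
    IsMinimalPolynomial s (C (m.coeff 0)⁻¹ * m) ∧
    IsGeneratorPolynomial n (seqCode n s) m ∧
    Module.finrank K (seqCode n s) = n - ℓ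

end Codes

/-! ### Cyclotomic classes of prime modulus and the objects built from them -/

section Cyclotomy

variable {n : ℕ} [NeZero n]

open Classical in
/-- The cyclotomic class `C_i^{(N,n)} = αⁱ ⟨α^N⟩`. -/
def cycClass (α : (ZMod n)ˣ) (N i : ℕ) : Finset (ZMod n) :=
  Finset.univ.filter fun x => ∃ y ∈ Subgroup.zpowers (α ^ N), x = ((α ^ i * y : (ZMod n)ˣ) : ZMod n)

/-- `Ω_i(x) = ∏_{j ∈ C_i^{(4,n)}} (x - η^j)`. -/
def Omega {L : Type*} [Field L] (α : (ZMod n)ˣ) (η : L) (i : ℕ) : L[X] :=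
  ∏ j ∈ cycClass α 4 i, (X - C (η ^ j.val))

/-- `η_i = ∑_{j ∈ C_i^{(4,n)}} η^j`. -/
def etaSum {L : Type*} [Field L] (α : (ZMod n)ˣ) (η : L) (i : ℕ) : L :=
  ∑ j ∈ cycClass α 4 i, η ^ j.val

/-- The sequence of period `n` with value `1` on `C₁ ∪ C₂ ∪ C₃`, `0` on `C₀` and `ρ` at `0`
(classes of order four). -/
def cycSeq {K : Type*} [Field K] (α : (ZMod n)ˣ) (ρ : K) (i : ℕ) : K :=
  if (i : ZMod n) ∈ cycClass α 4 1 ∪ cycClass α 4 2 ∪ cycClass α 4 3 then 1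
  else if (i : ZMod n) ∈ cycClass α 4 0 then 0
  else ρ

end Cyclotomy

/-! ### The two lower bounds on the minimum weight -/

/-- With `r = q^((n-1)/4)`, `N = (r-1)/n` and `N₁ = N/(q-1)`, the bound
`⌈(q-1)(r - ⌊(N₁-1)√r⌋)/(qN)⌉` (for the check polynomial `Ω_i`). -/
def irrBound (q n : ℕ) : ℤ :=
  let r : ℝ := (q : ℝ) ^ ((n - 1) / 4)
  let N : ℝ := (r - 1) / n
  let N₁ : ℝ := N / (q - 1)
  ⌈((q : ℝ) - 1) * (r - (⌊(N₁ - 1) * √r⌋ : ℤ)) / (q * N)⌉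

/-- With `r = q^((n-1)/4)` and `N = (r-1)/n`, the bound
`((q-1)(r-1)-1)/(qN) - ((q-1)/q)((N-1)√r/N)` (for the check polynomial `(x-1)Ω_i`). -/
def augBound (q n : ℕ) : ℝ :=
  let r : ℝ := (q : ℝ) ^ ((n - 1) / 4)
  let N : ℝ := (r - 1) / n
  (((q : ℝ) - 1) * (r - 1) - 1) / (q * N) - ((q : ℝ) - 1) / q * ((N - 1) * √r / N)

end CyclotomicCode

end

/-! Put f = (n-1)/4. Everything is read off from the discrete Fourier transform a ↦ Λ(η^a) on ℤ/n. A
recurrence with coefficient polynomial c holds exactly when c(η^a)Λ(η^a) = 0 for all a, so the set Z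
of exponents a with Λ(η^a) = 0 determines the minimal polynomial, the linear span, the generator
polynomial and the dimension (`seqCodeData_of_zeros`). Since p divides f, n = 1 in the field and
each class has size zero there. Hence Λ(1) = ρ, and Λ(η^a) = ρ - 1 - η_j for a in C_j
(`wdft_cycWord`): Z consists of the classes with η_j = ρ - 1, together with 0 if ρ = 0.

It remains to relate the periods η_j to A and B. For n ≡ 5 (mod 8) one has -1 ∈ C_2, so η_j η_{j+2}
counts differences of elements of C_0 (`etaSum_mul`). Together with η_0 + η_2 = 0 and η_1 + η_3 = -1
this gives η_0² = D(α) and η_1² + η_1 = D(1), where D(t) is the number of representations of t as a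
difference in C_0. Gauss' value 16 D(1) = n - 7 + 2u comes from the Jacobi sum of a quartic
character in ℤ[i], and a count of all pairs then gives D(α). The outcome is A = f - D(α) and B = f -
D(1), so modulo p, A = -η_0² and B = -(η_1² + η_1) (`param_modEq_iff`), and the six cases become
conditions on η_0 and η_1.

The weight bounds have three sources. In the duadic case, an odd-like word is convolved with its
image under -1; the result has a transform supported at 0, hence is a nonzero constant, which forces
√n nonzero coordinates (`le_hammingNorm_sq`). For the even-like quadratic residue code, the
Gleason–Prange map turns a word into an odd-like one of no larger weight
(`le_hammingNorm_sq_of_dft_eq_zero`). The bounds 𝓑₁ and 𝓑₂ follow from a second moment argument: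
distinct coordinates of a shift-invariant code of dimension at least two are pairwise independent,
the orbit of a word under shifts (and scalars) has constant deviation, and Cauchy–Schwarz is applied
to the remaining nonzero words (`orbit_bound`). -/

noncomputable section

namespace CyclotomicCode

/-! ### Fourier transform on ℤ/n and the square root bound for odd-like words -/

section Fourier

variable {n : ℕ} [NeZero n] {L : Type*} [Field L]

/-- The discrete Fourier transform on `ℤ/n` with respect to the additive character `ψ`. -/
def dft (ψ : AddChar (ZMod n) L) (f : ZMod n → L) (a : ZMod n) : L := ∑ i, f i * ψ (a * i)

theorem dft_zero (ψ : AddChar (ZMod n) L) (f : ZMod n → L) : dft ψ f 0 = ∑ i, f i := by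
  simp [dft]

theorem sum_dft_mul {ψ : AddChar (ZMod n) L} (hψ : ψ.IsPrimitive) (f : ZMod n → L)
    (j : ZMod n) : ∑ a, dft ψ f a * ψ (-(a * j)) = n * f j := by
  simp only [dft, Finset.sum_mul]
  rw [Finset.sum_comm]
  have h : ∀ i : ZMod n, ∑ a, f i * ψ (a * i) * ψ (-(a * j)) = if i = j then (n : L) * f j else 0 := by
    intro i
    have : ∀ a : ZMod n, f i * ψ (a * i) * ψ (-(a * j)) = f i * ψ (a * (i - j)) := by
      intro a
      rw [mul_assoc, ← AddChar.map_add_eq_mul]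
      congr 2; ring
    simp only [this, ← Finset.mul_sum]
    rw [AddChar.sum_mulShift _ hψ]
    by_cases hij : i = j
    · simp [hij, mul_comm]
    · simp [hij, sub_eq_zero]
  simp [h]

theorem eq_zero_of_dft_eq_zero {ψ : AddChar (ZMod n) L} (hψ : ψ.IsPrimitive) (hn : (n : L) ≠ 0)
    {f : ZMod n → L} (h : ∀ a, dft ψ f a = 0) (j : ZMod n) : f j = 0 := by
  have := sum_dft_mul hψ f j
  simp only [h, zero_mul, Finset.sum_const_zero] at this
  exact (mul_eq_zero.mp this.symm).resolve_left hn

/-- Cyclic convolution. -/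
def cconv (f g : ZMod n → L) (k : ZMod n) : L := ∑ i, f i * g (k - i)

theorem dft_cconv (ψ : AddChar (ZMod n) L) (f g : ZMod n → L) (a : ZMod n) :
    dft ψ (cconv f g) a = dft ψ f a * dft ψ g a := by
  simp only [dft, cconv, Finset.sum_mul]
  rw [Finset.sum_comm]
  refine Finset.sum_congr rfl fun i _ => ?_
  rw [Finset.mul_sum, ← Equiv.sum_comp (Equiv.addRight i)]
  refine Finset.sum_congr rfl fun k _ => ?_
  simp only [Equiv.coe_addRight, add_sub_cancel_right, mul_add, AddChar.map_add_eq_mul]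
  ring

theorem dft_mulShift (ψ : AddChar (ZMod n) L) (f : ZMod n → L) (b : (ZMod n)ˣ) (a : ZMod n) :
    dft ψ (fun i => f ((b⁻¹ : (ZMod n)ˣ) * i)) a = dft ψ f (b * a) := by
  simp only [dft]
  rw [← Equiv.sum_comp (Units.mulLeft b)]
  refine Finset.sum_congr rfl fun i _ => ?_
  simp only [Units.mulLeft_apply, Units.inv_mul_cancel_left]
  congr 2; ring

theorem dft_addShift (ψ : AddChar (ZMod n) L) (f : ZMod n → L) (δ a : ZMod n) :
    dft ψ (fun i => f (i + δ)) a = ψ (-(a * δ)) * dft ψ f a := by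
  simp only [dft, Finset.mul_sum]
  rw [← Equiv.sum_comp (Equiv.addRight δ) (fun i => ψ (-(a * δ)) * (f i * ψ (a * i)))]
  refine Finset.sum_congr rfl fun i _ => ?_
  simp only [Equiv.coe_addRight]
  rw [mul_left_comm, ← AddChar.map_add_eq_mul]
  congr 2; ring

open Classical in
/-- The square root bound: an odd-like word whose transform vanishes at one of `a`, `ba` for each
nonzero `a` has at least `√n` nonzero coordinates. -/
theorem le_hammingNorm_sq {ψ : AddChar (ZMod n) L} (hψ : ψ.IsPrimitive)
    {f : ZMod n → L} (h0 : ∑ i, f i ≠ 0) (b : (ZMod n)ˣ)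
    (h : ∀ a, a ≠ 0 → dft ψ f a = 0 ∨ dft ψ f (b * a) = 0) :
    n ≤ hammingNorm f ^ 2 := by
  set g : ZMod n → L := fun i => f ((b⁻¹ : (ZMod n)ˣ) * i)
  have hd : ∀ a, dft ψ (cconv f g) a = dft ψ f a * dft ψ f (b * a) := fun a => by
    rw [dft_cconv, dft_mulShift]
  -- The transform of the convolution survives only at 0, where it is (∑ f)²; by inversion the
  -- convolution is a nonzero constant divided by n.
  have hne : ∀ j, cconv f g j ≠ 0 := by
    intro j hj
    have hs := sum_dft_mul hψ (cconv f g) j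
    rw [hj, mul_zero, Finset.sum_eq_single 0] at hs
    · rw [hd, mul_zero, dft_zero] at hs
      simp [h0] at hs
    · intro a _ ha
      rw [hd]
      rcases h a ha with h | h <;> simp [h]
    · simp
  set S : Finset (ZMod n) := Finset.univ.filter fun i => f i ≠ 0
  have hS : S.card = hammingNorm f := by simp only [S, hammingNorm]
  -- A nonvanishing convolution means every residue is x + b y with x, y in the support, so n ≤
  -- |S|².
  have hsub : (Finset.univ : Finset (ZMod n)) ⊆ (S ×ˢ S).image fun x => x.1 + b * x.2 := by
    intro j _
    obtain ⟨i, -, hi⟩ := Finset.exists_ne_zero_of_sum_ne_zero (hne j)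
    refine Finset.mem_image.mpr ⟨(i, (b⁻¹ : (ZMod n)ˣ) * (j - i)), ?_, by simp⟩
    simp only [Finset.mem_product, S, Finset.mem_filter, Finset.mem_univ, true_and]
    exact ⟨left_ne_zero_of_mul hi, right_ne_zero_of_mul hi⟩
  have := (Finset.card_le_card hsub).trans Finset.card_image_le
  rwa [Finset.card_univ, ZMod.card, Finset.card_product, hS, ← sq] at this

end Fourier

/-! ### Salié sums and the Gleason–Prange transformation -/

section Quadratic

variable {n : ℕ} [Fact n.Prime] {L : Type*} [Field L]

/-- The quadratic character of `ℤ/n` with values in `L`. -/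
abbrev legendreChar (n : ℕ) [Fact n.Prime] (L : Type*) [Field L] : MulChar (ZMod n) L :=
  (quadraticChar (ZMod n)).ringHomComp (Int.castRingHom L)

theorem legendreChar_sq_one {a : ZMod n} (ha : a ≠ 0) :
    legendreChar n L a * legendreChar n L a = 1 := by
  have := quadraticChar_sq_one ha
  rw [MulChar.ringHomComp_apply, ← map_mul, ← sq, this, map_one]

theorem legendreChar_ne_zero {a : ZMod n} (ha : a ≠ 0) : legendreChar n L a ≠ 0 :=
  left_ne_zero_of_mul_eq_one (legendreChar_sq_one ha)

theorem legendreChar_inv (a : ZMod n) : legendreChar n L a⁻¹ = legendreChar n L a := by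
  by_cases ha : a = 0
  · simp [ha]
  · have h := legendreChar_sq_one (L := L) ha
    have h' : legendreChar n L a⁻¹ * legendreChar n L a = 1 := by
      rw [← map_mul, inv_mul_cancel₀ ha, map_one]
    exact mul_right_cancel₀ (legendreChar_ne_zero ha) (h'.trans h.symm)

theorem legendreChar_of_isSquare {a : ZMod n} (ha : a ≠ 0) (h : IsSquare a) :
    legendreChar n L a = 1 := by
  simp [MulChar.ringHomComp_apply, (quadraticChar_one_iff_isSquare ha).mpr h]

theorem legendreChar_of_not_isSquare {a : ZMod n} (h : ¬ IsSquare a) :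
    legendreChar n L a = -1 := by
  simp [MulChar.ringHomComp_apply, quadraticChar_neg_one_iff_not_isSquare.mpr h]

/-- Inversion scaled by `b ≠ 0`, as a permutation of a field. -/
def divEquiv {F : Type*} [Field F] {b : F} (hb : b ≠ 0) : F ≃ F where
  toFun i := b * i⁻¹
  invFun i := b * i⁻¹
  left_inv i := by field_simp
  right_inv i := by field_simp

/-- The Salié sum of `a` and `b` vanishes if `ab` is a nonsquare. -/
theorem sum_salie_eq_zero (h2 : (2 : L) ≠ 0) (ψ : AddChar (ZMod n) L) {a b : ZMod n}
    (hb : b ≠ 0) (hbs : IsSquare b) (ha : ¬ IsSquare a) :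
    ∑ i, legendreChar n L i * ψ (b * i⁻¹ + a * i) = 0 := by
  have ha0 : a ≠ 0 := by rintro rfl; exact ha (IsSquare.zero)
  -- The substitution i ↦ b/(a i) exchanges the two terms in the argument of ψ and multiplies the
  -- character by -1, as b/a is a nonsquare.
  have key : ∑ i, legendreChar n L i * ψ (b * i⁻¹ + a * i) =
      - ∑ i, legendreChar n L i * ψ (b * i⁻¹ + a * i) := by
    conv_lhs => rw [← Equiv.sum_comp (divEquiv (mul_ne_zero hb (inv_ne_zero ha0)))]
    rw [← Finset.sum_neg_distrib]
    refine Finset.sum_congr rfl fun i _ => ?_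
    simp only [divEquiv, Equiv.coe_fn_mk, map_mul, legendreChar_inv, mul_inv, inv_inv]
    rw [legendreChar_of_isSquare hb hbs, legendreChar_of_not_isSquare ha]
    have e1 : b * (b⁻¹ * a * i) = a * i := by field_simp
    have e2 : a * (b * a⁻¹ * i⁻¹) = b * i⁻¹ := by field_simp
    rw [e1, e2, add_comm]; ring
  have : (2 : L) * ∑ i, legendreChar n L i * ψ (b * i⁻¹ + a * i) = 0 := by
    rw [two_mul]; nth_rewrite 1 [key]; exact neg_add_cancel _
  exact (mul_eq_zero.mp this).resolve_left h2

/-- The degenerate Salié sum with a = 0. It supplies the coordinate sum of the Gleason–Prange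
transform. -/
theorem sum_legendreChar_inv (ψ : AddChar (ZMod n) L) {b : ZMod n}
    (hb : b ≠ 0) (hbs : IsSquare b) :
    ∑ i, legendreChar n L i * ψ (b * i⁻¹) = gaussSum (legendreChar n L) ψ := by
  rw [gaussSum, ← Equiv.sum_comp (divEquiv hb)]
  refine Finset.sum_congr rfl fun i _ => ?_
  simp only [divEquiv, Equiv.coe_fn_mk, map_mul, legendreChar_inv, mul_inv, inv_inv]
  rw [legendreChar_of_isSquare hb hbs, one_mul]
  congr 2; field_simp

theorem legendreChar_ne_one (hn2 : n ≠ 2) (h2 : (2 : L) ≠ 0) : legendreChar n L ≠ 1 := by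
  obtain ⟨a, ha⟩ := quadraticChar_exists_neg_one (F := ZMod n) (by rwa [ZMod.ringChar_zmod_n])
  intro h
  have h1 := DFunLike.congr_fun h a
  have ha0 : a ≠ 0 := by rintro rfl; simp at ha
  rw [legendreChar_of_not_isSquare (quadraticChar_neg_one_iff_not_isSquare.mp ha),
    MulChar.one_apply ha0.isUnit] at h1
  exact h2 (by linear_combination -h1)

/-- The square root bound for even-like quadratic residue codes: the Gleason–Prange
transformation produces an odd-like word of no larger weight. -/
theorem le_hammingNorm_sq_of_dft_eq_zero [DecidableEq L] (hn2 : n ≠ 2) (h2 : (2 : L) ≠ 0)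
    (hn : (n : L) ≠ 0)
    {ψ : AddChar (ZMod n) L} (hψ : ψ.IsPrimitive) {f : ZMod n → L} (hf : f ≠ 0)
    (h : ∀ a, a = 0 ∨ ¬ IsSquare a → dft ψ f a = 0) : n ≤ hammingNorm f ^ 2 := by
  classical
  obtain ⟨δ, hδ⟩ := Function.ne_iff.mp hf
  -- The coordinate sum of the transformed word turns out to be a Gauss sum times the value at 0, so
  -- the word is shifted first to make that value nonzero.
  set f' : ZMod n → L := fun i => f (i + δ)
  have hf0 : f' 0 ≠ 0 := by simpa [f'] using hδ
  have hf' : ∀ a, a = 0 ∨ ¬ IsSquare a → dft ψ f' a = 0 := fun a ha => by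
    rw [dft_addShift, h a ha, mul_zero]
  set g : ZMod n → L := fun i => legendreChar n L i * f' (-i⁻¹)
  -- Writing f'(-1/i) by Fourier inversion turns the transform of g into a combination of Salié
  -- sums; only nonzero squares b contribute.
  have hg : ∀ a, n * dft ψ g a =
      ∑ b, dft ψ f' b * ∑ i, legendreChar n L i * ψ (b * i⁻¹ + a * i) := by
    intro a
    simp only [dft, g]
    simp only [Finset.mul_sum]
    rw [Finset.sum_comm]
    refine Finset.sum_congr rfl fun i _ => ?_
    have := sum_dft_mul hψ f' (-i⁻¹)
    calc _ = legendreChar n L i * ψ (a * i) * (n * f' (-i⁻¹)) := by ring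
      _ = _ := by
        rw [← this, Finset.mul_sum]
        refine Finset.sum_congr rfl fun b _ => ?_
        rw [AddChar.map_add_eq_mul, mul_neg, neg_neg, dft]
        ring
  have hga : ∀ a, ¬ IsSquare a → dft ψ g a = 0 := by
    intro a ha
    have := hg a
    rw [Finset.sum_eq_zero] at this
    · exact (mul_eq_zero.mp this).resolve_left hn
    · intro b _
      by_cases hb : b = 0 ∨ ¬ IsSquare b
      · rw [hf' b hb, zero_mul]
      · push Not at hb
        rw [sum_salie_eq_zero h2 ψ hb.1 hb.2 ha, mul_zero]
  have hg0 : ∑ i, g i ≠ 0 := by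
    intro h0
    have h1 := hg 0
    rw [dft_zero, h0, mul_zero] at h1
    have h3 : ∀ b, dft ψ f' b * ∑ i, legendreChar n L i * ψ (b * i⁻¹ + 0 * i) =
        gaussSum (legendreChar n L) ψ * (dft ψ f' b * ψ (-(b * 0))) := by
      intro b
      simp only [zero_mul, add_zero, mul_zero, neg_zero, AddChar.map_zero_eq_one, mul_one]
      by_cases hb : b = 0 ∨ ¬ IsSquare b
      · rw [hf' b hb, zero_mul, mul_zero]
      · push Not at hb
        rw [sum_legendreChar_inv ψ hb.1 hb.2, mul_comm]
    rw [Finset.sum_congr rfl fun b _ => h3 b, ← Finset.mul_sum, sum_dft_mul hψ] at h1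
    refine mul_ne_zero ?_ (mul_ne_zero hn hf0) h1.symm
    exact gaussSum_ne_zero_of_nontrivial (by rwa [ZMod.card]) (legendreChar_ne_one hn2 h2) hψ
  obtain ⟨b, hb⟩ := quadraticChar_exists_neg_one' (F := ZMod n) (by rwa [ZMod.ringChar_zmod_n])
  have hle : n ≤ hammingNorm g ^ 2 := by
    convert le_hammingNorm_sq hψ hg0 b ?_
    intro a ha
    by_cases has : IsSquare a
    · refine Or.inr (hga _ (quadraticChar_neg_one_iff_not_isSquare.mp ?_))
      rw [map_mul, hb, (quadraticChar_one_iff_isSquare ha).mpr has, mul_one]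
    · exact Or.inl (hga a has)
  refine hle.trans (Nat.pow_le_pow_left ?_ 2)
  -- The transformation permutes coordinates and rescales them, killing the one at 0, so the weight
  -- does not grow.
  refine Finset.card_le_card_of_injOn (fun i => -i⁻¹ + δ) ?_ ?_
  · intro i hi
    simp only [Finset.coe_filter, Finset.mem_univ, true_and, Set.mem_ofPred_eq, g, f'] at hi ⊢
    exact right_ne_zero_of_mul hi
  · intro i _ j _ hij
    simpa using hij

end Quadratic

/-! ### Polynomials with prescribed zeros among the n-th roots of unity -/

section RootProducts

variable {n : ℕ} [NeZero n] {L : Type*} [Field L] {η : L}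

/-- The additive character of `ℤ/n` with `1 ↦ η`. -/
abbrev rootChar (hη : IsPrimitiveRoot η n) : AddChar (ZMod n) L :=
  AddChar.zmodChar n hη.pow_eq_one

theorem rootChar_isPrimitive (hη : IsPrimitiveRoot η n) : (rootChar hη).IsPrimitive :=
  AddChar.zmodChar_primitive_of_primitive_root n hη

theorem rootChar_apply (hη : IsPrimitiveRoot η n) (a : ZMod n) : rootChar hη a = η ^ a.val :=
  AddChar.zmodChar_apply _ a

theorem rootChar_mul_natCast (hη : IsPrimitiveRoot η n) (a : ZMod n) (j : ℕ) :
    rootChar hη (a * j) = (η ^ a.val) ^ j := by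
  rw [mul_comm, ← nsmul_eq_mul, AddChar.map_nsmul_eq_pow, rootChar_apply]

theorem pow_val_injective (hη : IsPrimitiveRoot η n) :
    Function.Injective fun a : ZMod n => η ^ a.val := fun a b h =>
  ZMod.val_injective n (hη.pow_inj (ZMod.val_lt a) (ZMod.val_lt b) h)

omit [NeZero n] in
theorem pow_val_pow (hη : IsPrimitiveRoot η n) (a : ZMod n) : (η ^ a.val) ^ n = 1 := by
  rw [← pow_mul, mul_comm, pow_mul, hη.pow_eq_one, one_pow]

/-- `∏_{a ∈ Z} (x - η^a)`. -/
def rootProd (η : L) (Z : Finset (ZMod n)) : L[X] := ∏ a ∈ Z, (X - C (η ^ a.val))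

omit [NeZero n] in
theorem rootProd_monic (η : L) (Z : Finset (ZMod n)) : (rootProd η Z).Monic :=
  monic_prod_of_monic _ _ fun _ _ => monic_X_sub_C _

omit [NeZero n] in
theorem rootProd_natDegree (η : L) (Z : Finset (ZMod n)) : (rootProd η Z).natDegree = Z.card := by
  rw [rootProd, natDegree_prod_of_monic _ _ fun a _ => monic_X_sub_C _]
  simp only [natDegree_X_sub_C, Finset.sum_const, smul_eq_mul, mul_one]

theorem rootProd_dvd_iff (hη : IsPrimitiveRoot η n) (Z : Finset (ZMod n)) (p : L[X]) :
    rootProd η Z ∣ p ↔ ∀ a ∈ Z, p.eval (η ^ a.val) = 0 := by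
  constructor
  · intro h a ha
    have h1 : X - C (η ^ a.val) ∣ rootProd η Z :=
      Finset.dvd_prod_of_mem (fun a : ZMod n => X - C (η ^ a.val)) ha
    exact dvd_iff_isRoot.mp (h1.trans h)
  · intro h
    refine Finset.prod_dvd_of_coprime ?_ fun a ha => dvd_iff_isRoot.mpr (h a ha)
    intro a _ b _ hab
    exact isCoprime_X_sub_C_of_isUnit_sub
      (sub_ne_zero.mpr fun h => hab (pow_val_injective hη h)).isUnit

theorem rootProd_univ (hη : IsPrimitiveRoot η n) :
    rootProd η (Finset.univ : Finset (ZMod n)) = X ^ n - 1 := by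
  have hm : (X ^ n - 1 : L[X]).Monic := by
    simpa using monic_X_pow_sub_C (1 : L) (NeZero.ne n)
  refine (eq_of_monic_of_dvd_of_natDegree_le (rootProd_monic _ _) hm ?_ ?_).symm
  · rw [rootProd_dvd_iff hη]
    intro a _
    simp [pow_val_pow hη]
  · rw [rootProd_natDegree, Finset.card_univ, ZMod.card]
    simpa using (natDegree_X_pow_sub_C (n := n) (r := (1 : L))).le

theorem rootProd_mul_compl (hη : IsPrimitiveRoot η n) (Z : Finset (ZMod n)) :
    rootProd η Zᶜ * rootProd η Z = X ^ n - 1 := by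
  rw [← rootProd_univ hη, rootProd, rootProd, rootProd, mul_comm, Finset.prod_mul_prod_compl]

theorem div_rootProd (hη : IsPrimitiveRoot η n) (Z : Finset (ZMod n)) :
    (X ^ n - 1) / rootProd η Z = rootProd η Zᶜ := by
  rw [← rootProd_mul_compl hη Z, mul_div_cancel_right₀ _ (rootProd_monic η Z).ne_zero]

end RootProducts

/-! ### Recurrences, generator polynomials and dimension from the zero set -/

section Sequences

variable {n : ℕ} [NeZero n] {K L : Type*} [Field K] [Field L] [Algebra K L] {η : L}

/-- The transform over `L` of a word over `K`. -/
abbrev wdft (hη : IsPrimitiveRoot η n) (f : ZMod n → K) (a : ZMod n) : L :=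
  dft (rootChar hη) (fun i => algebraMap K L (f i)) a

theorem sum_zmod_eq_sum_range {M : Type*} [AddCommMonoid M] (g : ZMod n → M) :
    ∑ a, g a = ∑ i ∈ Finset.range n, g (i : ZMod n) := by
  refine Finset.sum_nbij' (fun a => a.val) (fun i => (i : ZMod n)) ?_ ?_ ?_ ?_ ?_
  · intro a _; exact Finset.mem_range.mpr (ZMod.val_lt a)
  · simp
  · intro a _; exact ZMod.natCast_zmod_val a
  · intro i hi; exact ZMod.val_cast_of_lt (Finset.mem_range.mp hi)
  · intro a _; rw [ZMod.natCast_zmod_val]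

theorem eval_map_seqPoly (hη : IsPrimitiveRoot η n) (F : ZMod n → K) (a : ZMod n) :
    ((seqPoly n fun i => F i).map (algebraMap K L)).eval (η ^ a.val) = wdft hη F a := by
  rw [wdft, dft, sum_zmod_eq_sum_range]
  simp only [seqPoly, Polynomial.map_sum, Polynomial.map_mul, map_C, Polynomial.map_pow, map_X,
    eval_finsetSum, eval_mul, eval_C, eval_pow, eval_X, rootChar_mul_natCast]

/-- A linear recurrence with coefficients `c` holds for a periodic sequence iff
`c(η^a) Λ(η^a) = 0` for all `a`. -/
theorem recurrence_iff (hη : IsPrimitiveRoot η n) (hn : (n : L) ≠ 0) (F : ZMod n → K)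
    (c : ℕ → K) (ℓ : ℕ) :
    (∀ i, ℓ ≤ i → ∑ j ∈ Finset.range (ℓ + 1), c j * F ((i - j : ℕ) : ZMod n) = 0) ↔
      ∀ a : ZMod n, (∑ j ∈ Finset.range (ℓ + 1), algebraMap K L (c j) * (η ^ a.val) ^ j) *
        wdft hη F a = 0 := by
  -- The left side of the recurrence is a cyclic convolution, so its transform is c(η^a)Λ(η^a).
  set t : ZMod n → K := fun i => ∑ j ∈ Finset.range (ℓ + 1), c j * F (i - j)
  have ht : ∀ i, ℓ ≤ i → ∑ j ∈ Finset.range (ℓ + 1), c j * F ((i - j : ℕ) : ZMod n) = t i := by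
    intro i hi
    refine Finset.sum_congr rfl fun j hj => ?_
    rw [Nat.cast_sub (by have := Finset.mem_range.mp hj; omega)]
  have hd : ∀ a, wdft hη t a = (∑ j ∈ Finset.range (ℓ + 1),
      algebraMap K L (c j) * (η ^ a.val) ^ j) * wdft hη F a := by
    intro a
    simp only [wdft, dft, t, map_sum, map_mul, Finset.sum_mul]
    rw [Finset.sum_comm]
    refine Finset.sum_congr rfl fun j _ => ?_
    rw [Finset.mul_sum, ← Equiv.sum_comp (Equiv.addRight (j : ZMod n))]
    refine Finset.sum_congr rfl fun i _ => ?_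
    simp only [Equiv.coe_addRight, add_sub_cancel_right, mul_add, AddChar.map_add_eq_mul,
      rootChar_mul_natCast]
    ring
  simp only [← hd]
  constructor
  · intro h a
    have h0 : ∀ x, t x = 0 := by
      intro x
      -- The recurrence is known only from index ℓ on; adding n ℓ gives a representative of x in
      -- that range.
      have hx := ht (x.val + n * ℓ)
        ((Nat.le_mul_of_pos_left ℓ (NeZero.pos n)).trans (Nat.le_add_left _ _))
      rw [h _ ((Nat.le_mul_of_pos_left ℓ (NeZero.pos n)).trans (Nat.le_add_left _ _))] at hx
      simpa using hx.symm
    simp [wdft, dft, h0]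
  · intro h i hi
    rw [ht i hi]
    have := eq_zero_of_dft_eq_zero (rootChar_isPrimitive hη) hn h (i : ZMod n)
    simpa using this

variable (K) in
/-- The coordinate change between words indexed by `Fin n` and by `ℤ/n`. -/
def toZMod (n : ℕ) [NeZero n] : (Fin n → K) ≃ₗ[K] (ZMod n → K) :=
  LinearEquiv.funCongrLeft K K
    { toFun := fun a : ZMod n => (⟨a.val, ZMod.val_lt a⟩ : Fin n)
      invFun := fun i => ((i : ℕ) : ZMod n)
      left_inv := fun a => ZMod.natCast_zmod_val a
      right_inv := fun i => Fin.ext (ZMod.val_cast_of_lt i.2) }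

theorem toZMod_apply (c : Fin n → K) (a : ZMod n) : toZMod K n c a = c ⟨a.val, ZMod.val_lt a⟩ := rfl

theorem toZMod_natCast (c : Fin n → K) (i : Fin n) : toZMod K n c ((i : ℕ) : ZMod n) = c i := by
  rw [toZMod_apply]; congr 1; exact Fin.ext (ZMod.val_cast_of_lt i.2)

theorem sum_zmod_eq_sum_fin {M : Type*} [AddCommMonoid M] (g : ZMod n → M) :
    ∑ a, g a = ∑ i : Fin n, g ((i : ℕ) : ZMod n) := by
  rw [sum_zmod_eq_sum_range, Finset.sum_range]

theorem hammingNorm_toZMod [DecidableEq K] (c : Fin n → K) :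
    hammingNorm (toZMod K n c) = hammingNorm c := by
  simp only [hammingNorm, Finset.card_filter, sum_zmod_eq_sum_fin, toZMod_natCast]

omit [NeZero n] in
theorem wordPoly_apply (c : Fin n → K) : wordPoly n c = ∑ i : Fin n, monomial (i : ℕ) (c i) := by
  simp [wordPoly]

theorem eval_map_wordPoly (hη : IsPrimitiveRoot η n) (c : Fin n → K) (a : ZMod n) :
    ((wordPoly n c).map (algebraMap K L)).eval (η ^ a.val) = wdft hη (toZMod K n c) a := by
  rw [wdft, dft, sum_zmod_eq_sum_fin, wordPoly_apply]
  simp only [Polynomial.map_sum, map_monomial, eval_finsetSum, eval_monomial, toZMod_natCast,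
    rootChar_mul_natCast]

omit [NeZero n] in
theorem mem_cyclicCode {g : K[X]} (hg : g ∣ X ^ n - 1) (c : Fin n → K) :
    c ∈ cyclicCode n g ↔ g ∣ wordPoly n c := by
  rw [cyclicCode, Submodule.mem_comap, Submodule.restrictScalars_mem, Ideal.mem_span_pair]
  constructor
  · rintro ⟨a, b, h⟩
    rw [← h]
    exact dvd_add (dvd_mul_left _ _) (hg.mul_left _)
  · rintro ⟨a, h⟩
    exact ⟨a, 0, by rw [h]; ring⟩

omit [NeZero n] in
theorem exists_wordPoly_eq {p : K[X]} (hp : p.natDegree < n) : ∃ c, wordPoly n c = p := by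
  refine ⟨fun i => p.coeff i, ?_⟩
  rw [wordPoly_apply]
  conv_rhs => rw [p.as_sum_range' n hp, Finset.sum_range]

/-- The code is the kernel of the map from words to K[x]/(g), which is onto because remainders
modulo g have degree below n. -/
theorem finrank_cyclicCode {g : K[X]} (hm : g.Monic) (hg : g ∣ X ^ n - 1) :
    Module.finrank K (cyclicCode n g) = n - g.natDegree := by
  have hdeg : g.natDegree ≤ n := by
    have h := natDegree_le_of_dvd hg (by
      simpa using (monic_X_pow_sub_C (1 : K) (NeZero.ne n)).ne_zero)
    rwa [← C_1, natDegree_X_pow_sub_C] at h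
  let φ : (Fin n → K) →ₗ[K] K[X] ⧸ Ideal.span {g} :=
    (Ideal.Quotient.mkₐ K (Ideal.span {g})).toLinearMap ∘ₗ wordPoly n
  have hker : LinearMap.ker φ = cyclicCode n g := by
    ext c
    rw [mem_cyclicCode hg, LinearMap.mem_ker]
    simp only [φ, LinearMap.comp_apply, AlgHom.toLinearMap_apply, Ideal.Quotient.mkₐ_eq_mk,
      Ideal.Quotient.eq_zero_iff_mem, Ideal.mem_span_singleton]
  have hsurj : Function.Surjective φ := by
    intro y
    obtain ⟨p, rfl⟩ := Ideal.Quotient.mk_surjective y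
    -- For g = 1 the remainder has no strictly smaller `natDegree`; the quotient is then trivial.
    by_cases h1 : g = 1
    · refine ⟨0, ?_⟩
      rw [map_zero, eq_comm, Ideal.Quotient.eq_zero_iff_mem, h1, Ideal.mem_span_singleton]
      exact one_dvd p
    obtain ⟨c, hc⟩ := exists_wordPoly_eq (n := n) (p := p %ₘ g)
      ((natDegree_modByMonic_lt p hm h1).trans_le hdeg)
    refine ⟨c, ?_⟩
    simp only [φ, LinearMap.comp_apply, AlgHom.toLinearMap_apply, Ideal.Quotient.mkₐ_eq_mk, hc]
    rw [Ideal.Quotient.eq, Ideal.mem_span_singleton, modByMonic_eq_sub_mul_div]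
    exact ⟨-(p /ₘ g), by ring⟩
  have h1 := LinearMap.finrank_range_add_finrank_ker φ
  rw [hker, LinearMap.range_eq_top.mpr hsurj, finrank_top, finrank_quotient_span_eq_natDegree,
    Module.finrank_fin_fun] at h1
  omega

open Classical in
/-- The monic generator polynomial of the code of a periodic sequence, from the zeros of
`Λ` among the powers of `η`. -/
theorem exists_generator (hη : IsPrimitiveRoot η n) (F : ZMod n → K) (Z : Finset (ZMod n))
    (hZ : ∀ a, wdft hη F a = 0 ↔ a ∈ Z) :
    ∃ m : K[X], m.Monic ∧ m.map (algebraMap K L) = rootProd η Zᶜ ∧ m ∣ X ^ n - 1 ∧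
      seqCode n (fun i => F i) = cyclicCode n m := by
  set Λ := seqPoly n fun i => F i
  set G := EuclideanDomain.gcd Λ (X ^ n - 1)
  have hX0 : (X ^ n - 1 : K[X]) ≠ 0 := by
    simpa using (monic_X_pow_sub_C (1 : K) (NeZero.ne n)).ne_zero
  obtain ⟨m₀, hm₀⟩ : G ∣ X ^ n - 1 := EuclideanDomain.gcd_dvd_right _ _
  have hG0 : G ≠ 0 := left_ne_zero_of_mul (hm₀ ▸ hX0)
  have hm0 : m₀ ≠ 0 := right_ne_zero_of_mul (hm₀ ▸ hX0)
  have hdiv : (X ^ n - 1) / G = m₀ := by rw [hm₀, mul_div_cancel_left₀ _ hG0]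
  -- The gcd is determined only up to a unit, so its cofactor is made monic.
  set m := m₀ * C m₀.leadingCoeff⁻¹ with hmdef
  have hm : m.Monic := monic_mul_leadingCoeff_inv hm0
  have hu : IsUnit (C m₀.leadingCoeff⁻¹ : K[X]) :=
    isUnit_C.mpr (inv_ne_zero (leadingCoeff_ne_zero.mpr hm0)).isUnit
  have hass : Associated m₀ m := associated_mul_unit_right _ _ hu
  have hmd : m ∣ X ^ n - 1 := hass.symm.dvd.trans ⟨G, by rw [hm₀, mul_comm]⟩
  have hmap : (G.map (algebraMap K L)) * m₀.map (algebraMap K L) = X ^ n - 1 := by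
    rw [← Polynomial.map_mul, ← hm₀]; simp
  -- A Bézout identity over K remains valid over L, so the gcd has exactly the common zeros.
  have hGa : ∀ a : ZMod n, (G.map (algebraMap K L)).eval (η ^ a.val) = 0 ↔ a ∈ Z := by
    intro a
    rw [← hZ, ← eval_map_seqPoly]
    constructor
    · intro h
      obtain ⟨w, hw⟩ : G ∣ Λ := EuclideanDomain.gcd_dvd_left _ _
      change (Λ.map _).eval _ = 0
      rw [hw, Polynomial.map_mul, eval_mul, h, zero_mul]
    · intro h
      have hb : G = Λ * _ + (X ^ n - 1) * _ := EuclideanDomain.gcd_eq_gcd_ab Λ (X ^ n - 1)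
      rw [hb]
      simp only [Polynomial.map_add, Polynomial.map_mul, eval_add, eval_mul]
      rw [show (Λ.map (algebraMap K L)).eval (η ^ a.val) = 0 from h]
      simp [pow_val_pow hη]
  refine ⟨m, hm, ?_, hmd, ?_⟩
  · have hd1 : rootProd η Zᶜ ∣ m₀.map (algebraMap K L) := by
      rw [rootProd_dvd_iff hη]
      intro a ha
      have h2 := congrArg (eval (η ^ a.val)) hmap
      rw [eval_mul] at h2
      have h3 : eval (η ^ a.val) (X ^ n - 1 : L[X]) = 0 := by
        simp [pow_val_pow hη]
      rw [h3] at h2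
      exact (mul_eq_zero.mp h2).resolve_left fun h => Finset.mem_compl.mp ha ((hGa a).mp h)
    have hd2 : rootProd η Z ∣ G.map (algebraMap K L) := by
      rw [rootProd_dvd_iff hη]
      exact fun a ha => (hGa a).mpr ha
    have hX0' : (X ^ n - 1 : L[X]) ≠ 0 := by
      simpa using (monic_X_pow_sub_C (1 : L) (NeZero.ne n)).ne_zero
    -- Both factors of x^n - 1 are divisible by the expected root products; comparing total degrees
    -- leaves no room for anything else.
    have hdeg : (G.map (algebraMap K L)).natDegree + (m₀.map (algebraMap K L)).natDegree =
        (rootProd η Zᶜ).natDegree + (rootProd η Z).natDegree := by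
      rw [← natDegree_mul (rootProd_monic _ _).ne_zero (rootProd_monic _ _).ne_zero,
        rootProd_mul_compl hη, ← hmap, natDegree_mul] <;> simpa [Polynomial.map_eq_zero]
    have hle := natDegree_le_of_dvd hd2 (by simpa [Polynomial.map_eq_zero])
    refine eq_of_monic_of_dvd_of_natDegree_le (rootProd_monic _ _) (hm.map _) ?_ ?_
    · refine hd1.trans ?_
      rw [hmdef, Polynomial.map_mul]
      exact dvd_mul_right _ _
    · have : (m.map (algebraMap K L)).natDegree = (m₀.map (algebraMap K L)).natDegree := by
        rw [natDegree_map, natDegree_map, hmdef,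
          natDegree_mul_C (inv_ne_zero (leadingCoeff_ne_zero.mpr hm0))]
      omega
  · ext c
    rw [mem_cyclicCode hmd, ← hass.dvd_iff_dvd_left, seqCode]
    have := mem_cyclicCode (g := (X ^ n - 1) / G) (hdiv ▸ ⟨G, by rw [hm₀, mul_comm]⟩) c
    rw [hdiv] at this
    rw [← this, ← hdiv]

/-- Membership in the code of a sequence in terms of transforms. -/
theorem mem_seqCode_iff (hη : IsPrimitiveRoot η n) (F : ZMod n → K) (Z : Finset (ZMod n))
    (hZ : ∀ a, wdft hη F a = 0 ↔ a ∈ Z) (c : Fin n → K) :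
    c ∈ seqCode n (fun i => F i) ↔ ∀ a ∉ Z, wdft hη (toZMod K n c) a = 0 := by
  obtain ⟨m, -, hmap, hd, hD⟩ := exists_generator hη F Z hZ
  rw [hD, mem_cyclicCode hd, ← map_dvd_map' (algebraMap K L), hmap, rootProd_dvd_iff hη]
  simp only [Finset.mem_compl, eval_map_wordPoly hη]

/-- A polynomial gives a recurrence exactly when it vanishes at all η^a with a outside Z, that is,
when it is divisible by m. Normalizing the constant term of m therefore gives the minimal
polynomial, and the degree of m is the linear span. -/
theorem seqCodeData_of_zeros (hη : IsPrimitiveRoot η n) (hn : (n : L) ≠ 0) (F : ZMod n → K)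
    (Z : Finset (ZMod n)) (hZ : ∀ a, wdft hη F a = 0 ↔ a ∈ Z) {f : L[X]} (hf : f = rootProd η Z)
    {ℓ : ℕ} (hℓ : ℓ = n - Z.card) :
    SeqCodeData n (fun i => F i) ((X ^ n - 1) / f) ℓ := by
  obtain ⟨m, hm, hmap, hd, hD⟩ := exists_generator hη F Z hZ
  have hdeg : m.natDegree = ℓ := by
    rw [← natDegree_map (algebraMap K L), hmap, rootProd_natDegree, Finset.card_compl, ZMod.card,
      hℓ]
  have hle : ℓ ≤ n := by omega
  have hm0 : m.coeff 0 ≠ 0 := by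
    intro h0
    have h1 : X ∣ (X ^ n - 1 : K[X]) := (X_dvd_iff.mpr h0).trans hd
    rw [X_dvd_iff] at h1
    simp [coeff_X_pow, (NeZero.ne n).symm] at h1
  -- The length ℓ' may exceed the degree, since the definition of the linear span allows a vanishing
  -- last coefficient.
  have hrec : ∀ (ℓ' : ℕ) (c : K[X]), c.natDegree ≤ ℓ' →
      ((∀ i, ℓ' ≤ i → ∑ j ∈ Finset.range (ℓ' + 1), c.coeff j * F ((i - j : ℕ) : ZMod n) = 0) ↔
        m ∣ c) := by
    intro ℓ' c hc
    rw [recurrence_iff hη hn F c.coeff ℓ', ← map_dvd_map' (algebraMap K L), hmap,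
      rootProd_dvd_iff hη]
    refine ⟨fun h a ha => ?_, fun h a => ?_⟩
    · have h1 := (mul_eq_zero.mp (h a)).resolve_right
        fun h => Finset.mem_compl.mp ha ((hZ a).mp h)
      rw [eval_map, eval₂_eq_sum_range' _ (Nat.lt_succ_of_le hc)]
      exact h1
    · by_cases ha : a ∈ Z
      · rw [(hZ a).mpr ha, mul_zero]
      · have h1 := h a (Finset.mem_compl.mpr ha)
        rw [eval_map, eval₂_eq_sum_range' _ (Nat.lt_succ_of_le hc)] at h1
        rw [h1, zero_mul]
  set m' := C (m.coeff 0)⁻¹ * m with hm'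
  have hm'0 : m'.coeff 0 = 1 := by simp [hm', hm0]
  have hdeg' : m'.natDegree = ℓ := by
    rw [hm', natDegree_C_mul (inv_ne_zero hm0), hdeg]
  have hchar : IsCharacteristicPolynomial (fun i : ℕ => F i) m' :=
    ⟨hm'0, (hrec _ m' le_rfl).mpr (Dvd.intro_left _ rfl)⟩
  refine ⟨?_, m, ?_, ⟨hchar, ?_⟩, ⟨hm, hd, hD⟩, ?_⟩
  · refine IsLeast.csInf_eq ⟨⟨m'.coeff, hm'0, ?_⟩, ?_⟩
    · rw [← hdeg']; exact hchar.2
    · rintro ℓ' ⟨c, hc0, hc⟩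
      set p : K[X] := ∑ j ∈ Finset.range (ℓ' + 1), C (c j) * X ^ j
      have hpc : ∀ j, j ∈ Finset.range (ℓ' + 1) → p.coeff j = c j := by
        intro j hj
        simp only [p, finsetSum_coeff, coeff_C_mul, coeff_X_pow]
        simp only [mul_ite, mul_one, mul_zero, Finset.sum_ite_eq, hj, if_true]
      have hpd : p.natDegree ≤ ℓ' := by
        refine natDegree_sum_le_of_forall_le _ _ fun j hj => ?_
        exact (natDegree_C_mul_X_pow_le _ _).trans (Nat.lt_succ_iff.mp (Finset.mem_range.mp hj))
      have hp0 : p ≠ 0 := by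
        intro h
        have := hpc 0 (by simp)
        rw [h, hc0] at this
        simp at this
      have : m ∣ p := (hrec ℓ' p hpd).mp fun i hi => by
        rw [← hc i hi]
        exact Finset.sum_congr rfl fun j hj => by rw [hpc j hj]
      rw [← hdeg]
      exact (natDegree_le_of_dvd this hp0).trans hpd
  · rw [hmap, hf, div_rootProd hη]
  · rw [← hm']
    intro c' hc' hne
    have hdvd : m' ∣ c' := by
      have : m ∣ c' := (hrec _ c' le_rfl).mp hc'.2
      exact ((associated_unit_mul_left m _ (isUnit_C.mpr (inv_ne_zero hm0).isUnit)).dvd_iff_dvd_left).mpr this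
    have hc0 : c' ≠ 0 := by
      rintro rfl
      simpa using hc'.1
    -- With equal degrees the cofactor is a constant, and both constant terms are 1.
    refine lt_of_le_of_ne (natDegree_le_of_dvd hdvd hc0) fun heq => hne ?_
    obtain ⟨w, hw⟩ := hdvd
    have hw0 : w ≠ 0 := right_ne_zero_of_mul (hw ▸ hc0)
    have hm'ne : m' ≠ 0 := left_ne_zero_of_mul (hw ▸ hc0)
    have hwd : w.natDegree = 0 := by
      have h := congrArg natDegree hw
      rw [natDegree_mul hm'ne hw0] at h
      omega
    rw [eq_C_of_natDegree_eq_zero hwd] at hw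
    have h1 := congrArg (coeff · 0) hw
    simp only [coeff_mul_C, hm'0, hc'.1, one_mul] at h1
    rw [hw, ← h1, map_one, mul_one]
  · change Module.finrank K (seqCode n fun i : ℕ => F i) = n - ℓ
    rw [hD, finrank_cyclicCode hm hd, hdeg]

end Sequences

/-! ### Cyclotomic classes through a quartic character with values in ℤ[i] -/

section QuarticCharacter

/-- The imaginary unit of `ℤ[i]`. -/
def gaussI : GaussianIntˣ where
  val := ⟨0, 1⟩
  inv := ⟨0, -1⟩
  val_inv := by decide
  inv_val := by decide

theorem gaussI_sq : gaussI ^ 2 = -1 := by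
  rw [Units.ext_iff]; decide

theorem gaussI_pow_four : gaussI ^ 4 = 1 := by
  rw [show 4 = 2 * 2 from rfl, pow_mul, gaussI_sq]; simp

theorem orderOf_gaussI : orderOf gaussI = 4 := by
  refine orderOf_eq_prime_pow (p := 2) (n := 1) ?_ gaussI_pow_four
  rw [pow_one, gaussI_sq, Units.ext_iff]; decide

variable {n : ℕ} [Fact n.Prime] {α : (ZMod n)ˣ}

theorem gaussI_mem_rootsOfUnity (hn : n ≡ 5 [MOD 8]) :
    gaussI ∈ rootsOfUnity (Fintype.card (ZMod n)ˣ) GaussianInt := by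
  rw [mem_rootsOfUnity, ZMod.card_units, ← orderOf_dvd_iff_pow_eq_one, orderOf_gaussI]
  have : n % 8 = 5 := hn
  omega

/-- The quartic character of `ℤ/n` with `α ↦ i`. -/
def quarticChar (hn : n ≡ 5 [MOD 8]) (hα : ∀ x, x ∈ Subgroup.zpowers α) :
    MulChar (ZMod n) GaussianInt :=
  MulChar.ofRootOfUnity (gaussI_mem_rootsOfUnity hn) hα

variable (hn : n ≡ 5 [MOD 8]) (hα : ∀ x, x ∈ Subgroup.zpowers α)

theorem quarticChar_gen : quarticChar hn hα α = gaussI := MulChar.ofRootOfUnity_spec _ hα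

theorem quarticChar_gen_pow (k : ℕ) : quarticChar hn hα ((α ^ k : (ZMod n)ˣ) : ZMod n) =
    ((gaussI ^ k : GaussianIntˣ) : GaussianInt) := by
  rw [Units.val_pow_eq_pow_val, map_pow, quarticChar_gen, Units.val_pow_eq_pow_val]

include hα in
theorem exists_pow_eq {a : ZMod n} (ha : a ≠ 0) : ∃ k : ℕ, ((α ^ k : (ZMod n)ˣ) : ZMod n) = a := by
  obtain ⟨k, hk⟩ := mem_powers_iff_mem_zpowers.mpr (hα (Units.mk0 a ha))
  exact ⟨k, by simpa using congrArg Units.val hk⟩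

/-- As i ∈ ℤ[i] has order 4, this reduces all bookkeeping with classes to indices modulo 4. -/
theorem mem_cycClass_iff (a : ZMod n) (i : ℕ) :
    a ∈ cycClass α 4 i ↔ quarticChar hn hα a = ((gaussI ^ i : GaussianIntˣ) : GaussianInt) := by
  simp only [cycClass, Finset.mem_filter, Finset.mem_univ, true_and]
  constructor
  · rintro ⟨y, hy, rfl⟩
    obtain ⟨k, rfl⟩ := mem_powers_iff_mem_zpowers.mpr hy
    simp only [← pow_mul, ← pow_add, quarticChar_gen_pow]
    rw [pow_add, pow_mul, gaussI_pow_four, one_pow, mul_one]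
  · intro h
    have ha : a ≠ 0 := by
      rintro rfl
      rw [MulChar.map_zero] at h
      exact (gaussI ^ i).ne_zero h.symm
    obtain ⟨k, rfl⟩ := exists_pow_eq hα ha
    rw [quarticChar_gen_pow, Units.val_inj, pow_eq_pow_iff_modEq, orderOf_gaussI] at h
    refine ⟨(α ^ 4) ^ (((k : ℤ) - i) / 4), Subgroup.zpow_mem_zpowers _ _, ?_⟩
    have hd : (4 : ℤ) ∣ (k : ℤ) - i := (Nat.modEq_iff_dvd.mp h.symm)
    have : (i : ℤ) + 4 * (((k : ℤ) - i) / 4) = k := by rw [Int.mul_ediv_cancel' hd]; ring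
    congr 1
    rw [← zpow_natCast α 4, ← zpow_mul, ← zpow_natCast α i, ← zpow_add, ← zpow_natCast]
    congr 1; push_cast; exact this.symm

theorem gen_pow_mem (i : ℕ) : ((α ^ i : (ZMod n)ˣ) : ZMod n) ∈ cycClass α 4 i := by
  simp only [cycClass, Finset.mem_filter, Finset.mem_univ, true_and]
  exact ⟨1, one_mem _, by simp⟩

theorem ne_zero_of_mem_cycClass {a : ZMod n} {i : ℕ} (h : a ∈ cycClass α 4 i) : a ≠ 0 := by
  simp only [cycClass, Finset.mem_filter, Finset.mem_univ, true_and] at h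
  obtain ⟨y, -, rfl⟩ := h
  exact Units.ne_zero _

include hn hα in
theorem exists_mem_cycClass {a : ZMod n} (ha : a ≠ 0) : ∃ j < 4, a ∈ cycClass α 4 j := by
  obtain ⟨k, rfl⟩ := exists_pow_eq hα ha
  refine ⟨k % 4, Nat.mod_lt _ (by norm_num), ?_⟩
  rw [mem_cycClass_iff hn hα, quarticChar_gen_pow, Units.val_inj, pow_eq_pow_iff_modEq,
    orderOf_gaussI]
  exact (Nat.mod_modEq _ _).symm

include hn hα in
theorem cycClass_index_modEq {a : ZMod n} {i j : ℕ} (hi : a ∈ cycClass α 4 i)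
    (hj : a ∈ cycClass α 4 j) : i ≡ j [MOD 4] := by
  rw [mem_cycClass_iff hn hα] at hi hj
  rwa [hi, Units.val_inj, pow_eq_pow_iff_modEq, orderOf_gaussI] at hj

include hn hα in
theorem cycClass_congr {i j : ℕ} (h : i ≡ j [MOD 4]) : cycClass α 4 i = cycClass α 4 j := by
  ext a
  rw [mem_cycClass_iff hn hα, mem_cycClass_iff hn hα, Units.val_inj.mpr]
  rwa [pow_eq_pow_iff_modEq, orderOf_gaussI]

include hn hα in
theorem mul_mem_cycClass_iff {a x : ZMod n} {i j : ℕ} (ha : a ∈ cycClass α 4 j) :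
    a * x ∈ cycClass α 4 (j + i) ↔ x ∈ cycClass α 4 i := by
  rw [mem_cycClass_iff hn hα] at ha
  rw [mem_cycClass_iff hn hα, mem_cycClass_iff hn hα, map_mul, ha, pow_add, Units.val_mul]
  exact ⟨fun h => mul_left_cancel₀ (Units.ne_zero _) h, fun h => by rw [h]⟩

include hα in
theorem gen_pow_half (hn : n ≡ 5 [MOD 8]) : α ^ ((n - 1) / 2) = -1 := by
  have hn5 : n % 8 = 5 := hn
  have ho : orderOf α = n - 1 := by
    rw [orderOf_eq_card_of_forall_mem_zpowers hα, Nat.card_eq_fintype_card, ZMod.card_units]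
  have h1 : ((α ^ ((n - 1) / 2) : (ZMod n)ˣ) : ZMod n) ^ 2 = 1 := by
    rw [← Units.val_pow_eq_pow_val, ← pow_mul, show (n - 1) / 2 * 2 = n - 1 by omega, ← ho,
      pow_orderOf_eq_one]; rfl
  rcases sq_eq_one_iff.mp h1 with h | h
  · exfalso
    have h2 : α ^ ((n - 1) / 2) = 1 := Units.ext h
    have := Nat.le_of_dvd (by omega) (orderOf_dvd_of_pow_eq_one h2)
    omega
  · exact Units.ext h

include hα hn in
-- Here n ≡ 5 (mod 8) is decisive: -1 = α^((n-1)/2) and (n-1)/2 ≡ 2 (mod 4).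
theorem neg_one_mem_cycClass : (-1 : ZMod n) ∈ cycClass α 4 2 := by
  have h := gen_pow_mem (α := α) ((n - 1) / 2)
  rw [gen_pow_half hα hn] at h
  have hn5 : n % 8 = 5 := hn
  rw [cycClass_congr hn hα (i := 2) (j := (n - 1) / 2)]
  · simpa using h
  · change 2 % 4 = _ % 4; omega

include hα hn in
theorem neg_mem_cycClass_iff {a : ZMod n} {i : ℕ} :
    -a ∈ cycClass α 4 (i + 2) ↔ a ∈ cycClass α 4 i := by
  have := mul_mem_cycClass_iff hn hα (x := a) (i := i) (neg_one_mem_cycClass hn hα)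
  rwa [neg_one_mul, add_comm] at this

include hα hn in
theorem sum_cycClass_mul {M : Type*} [AddCommMonoid M] (g : ZMod n → M) {a : ZMod n} {i j : ℕ}
    (ha : a ∈ cycClass α 4 j) : ∑ x ∈ cycClass α 4 i, g (a * x) = ∑ y ∈ cycClass α 4 (j + i), g y := by
  have ha0 := ne_zero_of_mem_cycClass ha
  refine Finset.sum_nbij' (fun x => a * x) (fun y => a⁻¹ * y) ?_ ?_ ?_ ?_ ?_
  · intro x hx; exact (mul_mem_cycClass_iff hn hα ha).mpr hx
  · intro y hy
    refine (mul_mem_cycClass_iff hn hα ha).mp ?_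
    rwa [mul_inv_cancel_left₀ ha0]
  · intro x _; exact inv_mul_cancel_left₀ ha0 x
  · intro x _; exact mul_inv_cancel_left₀ ha0 x
  · intro x _; rfl

include hα hn in
theorem univ_eq_insert_cycClass : (Finset.univ : Finset (ZMod n)) =
    insert 0 ((Finset.range 4).biUnion (cycClass α 4)) := by
  ext a
  simp only [Finset.mem_univ, Finset.mem_insert, Finset.mem_biUnion, Finset.mem_range, true_iff]
  by_cases ha : a = 0
  · exact Or.inl ha
  · exact Or.inr (exists_mem_cycClass hn hα ha)

include hα hn in
theorem disjoint_cycClass {i j : ℕ} (h : ¬ i ≡ j [MOD 4]) :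
    Disjoint (cycClass α 4 i) (cycClass α 4 j) :=
  Finset.disjoint_left.mpr fun _ hi hj => h (cycClass_index_modEq hn hα hi hj)

include hα hn in
theorem sum_eq_sum_cycClass {M : Type*} [AddCommMonoid M] (g : ZMod n → M) :
    ∑ a, g a = g 0 + ∑ j ∈ Finset.range 4, ∑ x ∈ cycClass α 4 j, g x := by
  rw [univ_eq_insert_cycClass hn hα, Finset.sum_insert, Finset.sum_biUnion]
  · intro i hi j hj hij
    refine disjoint_cycClass hn hα fun h => hij ?_
    exact Nat.ModEq.eq_of_lt_of_lt h (Finset.mem_range.mp hi) (Finset.mem_range.mp hj)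
  · simp only [Finset.mem_biUnion, not_exists, not_and]
    intro j _ h
    exact ne_zero_of_mem_cycClass h rfl

include hα hn in
theorem card_cycClass (i : ℕ) : (cycClass α 4 i).card = (n - 1) / 4 := by
  have h0 : ∀ i, (cycClass α 4 i).card = (cycClass α 4 0).card := by
    intro i
    have := sum_cycClass_mul hn hα (fun _ => 1) (i := 0) (gen_pow_mem (α := α) i)
    simpa using this.symm
  have := sum_eq_sum_cycClass hn hα (fun _ : ZMod n => 1)
  simp only [Finset.sum_const, smul_eq_mul, mul_one, Finset.card_univ, ZMod.card, h0,
    Finset.card_range] at this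
  rw [h0]; omega

end QuarticCharacter

/-! ### Jacobi sums and the difference counts of C₀ -/

section CyclotomicNumbers

variable {n : ℕ} [Fact n.Prime] {α : (ZMod n)ˣ}
variable (hn : n ≡ 5 [MOD 8]) (hα : ∀ x, x ∈ Subgroup.zpowers α)

open Classical in
/-- The number of representations of `t` as a difference of two elements of `C₀`. -/
def diffCount (α : (ZMod n)ˣ) (t : ZMod n) : ℕ :=
  (Finset.univ.filter fun x => x ∈ cycClass α 4 0 ∧ x - t ∈ cycClass α 4 0).card

theorem gaussI_val_sq : (gaussI : GaussianInt) ^ 2 = -1 := by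
  rw [← Units.val_pow_eq_pow_val, gaussI_sq]; simp

theorem quarticChar_neg_one : quarticChar hn hα (-1) = -1 := by
  rw [(mem_cycClass_iff hn hα _ 2).mp (neg_one_mem_cycClass hn hα), Units.val_pow_eq_pow_val,
    gaussI_val_sq]

theorem quarticChar_pow_apply_gen {k : ℕ} (hk : k ≠ 0) :
    (quarticChar hn hα ^ k) α = (gaussI : GaussianInt) ^ k := by
  rw [MulChar.pow_apply' _ hk, quarticChar_gen]

theorem quarticChar_ne_one : quarticChar hn hα ≠ 1 := by
  rw [Ne, MulChar.eq_iff hα, quarticChar_gen, MulChar.one_apply_coe]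
  decide

theorem quarticChar_sq_ne_one : quarticChar hn hα ^ 2 ≠ 1 := by
  rw [Ne, MulChar.eq_iff hα, quarticChar_pow_apply_gen hn hα two_ne_zero, MulChar.one_apply_coe]
  decide

theorem quarticChar_pow_four : quarticChar hn hα ^ 4 = 1 := by
  rw [MulChar.eq_iff hα, quarticChar_pow_apply_gen hn hα four_ne_zero, MulChar.one_apply_coe]
  decide

theorem quarticChar_inv : (quarticChar hn hα)⁻¹ = quarticChar hn hα ^ 3 := by
  rw [inv_eq_iff_mul_eq_one, ← pow_succ', quarticChar_pow_four]

theorem quarticChar_sq_inv : (quarticChar hn hα ^ 2)⁻¹ = quarticChar hn hα ^ 2 := by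
  rw [inv_eq_iff_mul_eq_one, ← pow_add, quarticChar_pow_four]

theorem quarticChar_star :
    (quarticChar hn hα).ringHomComp (starRingEnd GaussianInt) = quarticChar hn hα ^ 3 := by
  rw [MulChar.eq_iff hα, quarticChar_pow_apply_gen hn hα three_ne_zero, MulChar.ringHomComp_apply,
    quarticChar_gen]
  decide

/-- Orthogonality of characters: four times the indicator function of C₀. -/
theorem sum_quarticChar_pow (x : ZMod n) [Decidable (x ∈ cycClass α 4 0)] :
    (1 : MulChar (ZMod n) GaussianInt) x + quarticChar hn hα x + (quarticChar hn hα ^ 2) x +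
      (quarticChar hn hα ^ 3) x = if x ∈ cycClass α 4 0 then 4 else 0 := by
  rw [MulChar.pow_apply' _ two_ne_zero, MulChar.pow_apply' _ three_ne_zero]
  by_cases hx : x = 0
  · subst hx
    rw [if_neg fun h => ne_zero_of_mem_cycClass h rfl]
    rw [MulChar.map_zero, MulChar.map_zero]
    norm_num
  · obtain ⟨j, hj, hm⟩ := exists_mem_cycClass hn hα hx
    rw [MulChar.one_apply (Ne.isUnit hx), (mem_cycClass_iff hn hα _ _).mp hm]
    have : x ∈ cycClass α 4 0 ↔ j = 0 :=
      ⟨fun h => Nat.ModEq.eq_of_lt_of_lt (cycClass_index_modEq hn hα hm h) hj (by norm_num),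
        fun h => h ▸ hm⟩
    simp only [this]
    interval_cases j <;> decide

/-- The norm formula |J|² = n, valid as χ and χ² are nontrivial; it is obtained in ℂ and pulled back
along the injection of ℤ[i]. -/
theorem jacobiSum_quarticChar_mul :
    jacobiSum (quarticChar hn hα) (quarticChar hn hα) *
      jacobiSum (quarticChar hn hα ^ 3) (quarticChar hn hα ^ 3) = n := by
  set χ := quarticChar hn hα
  have hinj : Function.Injective GaussianInt.toComplex := fun x y h => GaussianInt.toComplex_inj.mp h
  have h := jacobiSum_mul_jacobiSum_inv (F := ZMod n) (F' := ℂ)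
    (χ := χ.ringHomComp GaussianInt.toComplex) (φ := χ.ringHomComp GaussianInt.toComplex)
    ?_ ?_ ?_ ?_
  · apply hinj
    rw [map_mul, ← jacobiSum_ringHomComp, ← jacobiSum_ringHomComp, ← quarticChar_inv hn hα,
      ← MulChar.ringHomComp_inv, h, ZMod.card, map_natCast]
  · rw [ZMod.ringChar_zmod_n, ringChar.eq_zero]
    exact (NeZero.ne n).symm
  · exact (MulChar.ringHomComp_ne_one_iff hinj).mpr (quarticChar_ne_one hn hα)
  · exact (MulChar.ringHomComp_ne_one_iff hinj).mpr (quarticChar_ne_one hn hα)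
  · rw [← MulChar.ringHomComp_mul, MulChar.ringHomComp_ne_one_iff hinj, ← sq]
    exact quarticChar_sq_ne_one hn hα

theorem sum_mulChar_mul_sub_one (χ ψ : MulChar (ZMod n) GaussianInt) :
    ∑ x, χ x * ψ (x - 1) = ψ (-1) * jacobiSum χ ψ := by
  rw [jacobiSum, Finset.mul_sum]
  refine Finset.sum_congr rfl fun x _ => ?_
  rw [show x - 1 = -1 * (1 - x) by ring, map_mul]
  ring

/-- Expanding the product of two indicators gives sixteen signed Jacobi sums. Since χ(-1) = -1, the
mixed sums of χ or χ³ with χ² cancel in pairs, and all others except J(χ,χ) and J(χ³,χ³) are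
explicit integers. -/
theorem sixteen_mul_diffCount_one : (16 * diffCount α 1 : GaussianInt) = n - 7 -
    (jacobiSum (quarticChar hn hα) (quarticChar hn hα) +
      jacobiSum (quarticChar hn hα ^ 3) (quarticChar hn hα ^ 3)) := by
  classical
  have h1 : (16 * diffCount α 1 : GaussianInt) = ∑ x : ZMod n,
      (if x ∈ cycClass α 4 0 then (4 : GaussianInt) else 0) *
        (if x - 1 ∈ cycClass α 4 0 then (4 : GaussianInt) else 0) := by
    rw [diffCount, Finset.card_filter, Nat.cast_sum, Finset.mul_sum]
    refine Finset.sum_congr rfl fun x _ => ?_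
    by_cases h : x ∈ cycClass α 4 0 <;> by_cases h' : x - 1 ∈ cycClass α 4 0 <;> simp [h, h']
    norm_num
  rw [h1]
  simp only [← sum_quarticChar_pow hn hα]
  set χ := quarticChar hn hα with hχ
  have e1 : χ (-1) = -1 := quarticChar_neg_one hn hα
  have e2 : (χ ^ 2) (-1) = 1 := by rw [MulChar.pow_apply' _ two_ne_zero, e1]; norm_num
  have e3 : (χ ^ 3) (-1) = -1 := by rw [MulChar.pow_apply' _ three_ne_zero, e1]; norm_num
  have e0 : (1 : MulChar (ZMod n) GaussianInt) (-1) = 1 := MulChar.one_apply isUnit_one.neg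
  have n1 : χ ≠ 1 := quarticChar_ne_one hn hα
  have n2 : χ ^ 2 ≠ 1 := quarticChar_sq_ne_one hn hα
  have i1 : χ⁻¹ = χ ^ 3 := quarticChar_inv hn hα
  have i2 : (χ ^ 2)⁻¹ = χ ^ 2 := quarticChar_sq_inv hn hα
  have n3 : χ ^ 3 ≠ 1 := by rw [← i1]; exact inv_ne_one.mpr n1
  have j00 : jacobiSum (1 : MulChar (ZMod n) GaussianInt) 1 = n - 2 := by
    rw [jacobiSum_one_one, ZMod.card]
  have j01 := jacobiSum_one_nontrivial n1
  have j02 := jacobiSum_one_nontrivial n2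
  have j03 := jacobiSum_one_nontrivial n3
  have j10 := j01; rw [jacobiSum_comm] at j10
  have j20 := j02; rw [jacobiSum_comm] at j20
  have j30 := j03; rw [jacobiSum_comm] at j30
  have j13 := jacobiSum_nontrivial_inv n1; rw [i1, e1] at j13
  have j31 := j13; rw [jacobiSum_comm] at j31
  have j22 := jacobiSum_nontrivial_inv n2; rw [i2, e2] at j22
  have j12 := jacobiSum_comm χ (χ ^ 2)
  have j32 := jacobiSum_comm (χ ^ 3) (χ ^ 2)
  simp only [add_mul, mul_add, Finset.sum_add_distrib, sum_mulChar_mul_sub_one, e0, e1, e2, e3,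
    j00, j01, j02, j03, j10, j20, j30, j13, j31, j22, j12, j32]
  ring

/-- Uniqueness of the representation of a prime as `x² + 4y²`, up to signs. -/
theorem sq_eq_of_sq_add_four_mul_sq {n : ℕ} (hn : n.Prime) {u v s w : ℤ}
    (h1 : (n : ℤ) = u ^ 2 + 4 * v ^ 2) (h2 : (n : ℤ) = s ^ 2 + 4 * w ^ 2) : u ^ 2 = s ^ 2 := by
  have hn0 : (0 : ℤ) < n := by exact_mod_cast hn.pos
  -- The prime n divides one of the two factors. By the composition identity for sums of squares
  -- each factor e satisfies 4e² ≤ n², so the divisible one is 0.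
  have key : (u * w - v * s) * (u * w + v * s) = n * (w ^ 2 - v ^ 2) := by
    linear_combination (w ^ 2) * h1 * (-1) + v ^ 2 * h2
  have hzero : (u * w) ^ 2 = (v * s) ^ 2 := by
    have aux : ∀ e : ℤ, (n : ℤ) ∣ e → 4 * e ^ 2 ≤ (n : ℤ) ^ 2 → e = 0 := by
      rintro e ⟨k, rfl⟩ hle
      by_contra h
      have hk : k ≠ 0 := by rintro rfl; simp at h
      have : 1 ≤ k ^ 2 := by have := sq_pos_of_ne_zero hk; omega
      nlinarith [mul_pos hn0 hn0]
    have b1 : 4 * (u * w - v * s) ^ 2 ≤ (n : ℤ) ^ 2 := by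
      have : (n : ℤ) ^ 2 = (u * s + 4 * v * w) ^ 2 + 4 * (u * w - v * s) ^ 2 := by
        rw [sq (n : ℤ)]; nth_rewrite 1 [h1]; rw [h2]; ring
      nlinarith [sq_nonneg (u * s + 4 * v * w)]
    have b2 : 4 * (u * w + v * s) ^ 2 ≤ (n : ℤ) ^ 2 := by
      have : (n : ℤ) ^ 2 = (u * s - 4 * v * w) ^ 2 + 4 * (u * w + v * s) ^ 2 := by
        rw [sq (n : ℤ)]; nth_rewrite 1 [h1]; rw [h2]; ring
      nlinarith [sq_nonneg (u * s - 4 * v * w)]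
    have hp : Prime (n : ℤ) := Nat.prime_iff_prime_int.mp hn
    rcases hp.dvd_or_dvd (Dvd.intro _ key.symm) with h | h
    · have := aux _ h b1
      rw [sub_eq_zero.mp this]
    · have := aux _ h b2
      rw [eq_neg_of_add_eq_zero_left this, neg_sq]
  have hwv : w ^ 2 = v ^ 2 := by
    have h3 : (n : ℤ) * (w ^ 2 - v ^ 2) = 0 := by
      rw [← key]; linear_combination hzero
    have := (mul_eq_zero.mp h3).resolve_left hn0.ne'
    linarith
  linarith

include hn hα in
/-- Gauss' evaluation of the cyclotomic number `(0,0)` of order four, for `n ≡ 5 (mod 8)`. -/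
theorem sixteen_mul_diffCount_one_eq {u v : ℤ} (huv : (n : ℤ) = u ^ 2 + 4 * v ^ 2)
    (hu : u ≡ 1 [ZMOD 4]) : 16 * (diffCount α 1 : ℤ) = n - 7 + 2 * u := by
  set J := jacobiSum (quarticChar hn hα) (quarticChar hn hα) with hJ
  have hstar : jacobiSum (quarticChar hn hα ^ 3) (quarticChar hn hα ^ 3) = star J := by
    rw [← quarticChar_star hn hα, jacobiSum_ringHomComp]; rfl
  have h1 := sixteen_mul_diffCount_one hn hα
  have h2 := jacobiSum_quarticChar_mul hn hα
  rw [hstar, ← hJ] at h1 h2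
  have r1 := congrArg Zsqrtd.re h1
  have r2 := congrArg Zsqrtd.re h2
  simp at r1 r2
  have hn5 : (n : ℤ) % 8 = 5 := by exact_mod_cast (hn : n % 8 = 5 % 8)
  have hP : (n : ℤ) = J.re ^ 2 + J.im ^ 2 := by linarith
  have hev : Even J.im := by
    -- Integrality of the count in 16 D(1) = n - 7 - 2 Re J fixes Re J modulo 4, and with it the
    -- sign of u: the congruence u ≡ 1 (mod 4) leaves only u = -Re J.
    have h4 : J.re % 4 = 3 := by omega
    have h8 : J.re ^ 2 % 8 = 1 := by
      obtain ⟨k, hk⟩ : ∃ k, J.re = 4 * k + 3 := ⟨J.re / 4, by omega⟩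
      rw [hk, show (4 * k + 3) ^ 2 = 8 * (2 * k ^ 2 + 3 * k + 1) + 1 by ring]
      omega
    have h5 : J.im ^ 2 % 2 = 0 := by omega
    exact (Int.even_pow' two_ne_zero).mp (Int.even_iff.mpr h5)
  obtain ⟨w, hw⟩ := hev
  have hsq := sq_eq_of_sq_add_four_mul_sq (Fact.out : n.Prime) huv
    (s := -J.re) (w := w) (by rw [hP, hw]; ring)
  have hu4 : u % 4 = 1 := hu
  rcases sq_eq_sq_iff_eq_or_eq_neg.mp hsq with h | h <;> omega

theorem diffCount_neg (t : ZMod n) : diffCount α (-t) = diffCount α t := by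
  classical
  refine Finset.card_nbij' (fun x => x + t) (fun x => x - t) ?_ ?_ ?_ ?_
  · intro x hx; simpa [and_comm] using hx
  · intro x hx; simpa [and_comm] using hx
  · intro x _; simp
  · intro x _; simp

include hn hα in
theorem diffCount_mul {a : ZMod n} (ha : a ∈ cycClass α 4 0) (t : ZMod n) :
    diffCount α (a * t) = diffCount α t := by
  classical
  have ha0 := ne_zero_of_mem_cycClass ha
  have hm : ∀ x, a * x ∈ cycClass α 4 0 ↔ x ∈ cycClass α 4 0 := fun x =>
    mul_mem_cycClass_iff hn hα (i := 0) ha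
  symm
  refine Finset.card_nbij' (fun x => a * x) (fun x => a⁻¹ * x) ?_ ?_ ?_ ?_
  · intro x hx
    simp only [Finset.coe_filter, Finset.mem_univ, true_and, Set.mem_ofPred_eq, ← mul_sub, hm]
      at hx ⊢
    exact hx
  · intro x hx
    simp only [Finset.coe_filter, Finset.mem_univ, true_and, Set.mem_ofPred_eq] at hx ⊢
    rw [← hm, ← hm (a⁻¹ * x - t), mul_sub, mul_inv_cancel_left₀ ha0]
    exact hx
  · intro x _; exact inv_mul_cancel_left₀ ha0 x
  · intro x _; exact mul_inv_cancel_left₀ ha0 x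

include hn hα in
theorem diffCount_of_mem {t : ZMod n} {j : ℕ} (ht : t ∈ cycClass α 4 j) :
    diffCount α t = diffCount α ((α ^ j : (ZMod n)ˣ) : ZMod n) := by
  set b : ZMod n := ((α ^ j : (ZMod n)ˣ) : ZMod n) with hb
  have hb0 : b ≠ 0 := Units.ne_zero _
  have h : t * b⁻¹ ∈ cycClass α 4 0 := by
    rw [← mul_mem_cycClass_iff hn hα (i := 0) (gen_pow_mem (α := α) j), ← hb, add_zero, mul_comm t,
      mul_inv_cancel_left₀ hb0]
    exact ht
  have := diffCount_mul hn hα h b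
  rwa [mul_assoc, inv_mul_cancel₀ hb0, mul_one] at this

include hn hα in
-- The count is even in t and -1 lies in C₂; so on nonzero t only two values occur, D(1) and D(α).
theorem diffCount_gen_pow_add_two (j : ℕ) : diffCount α ((α ^ (j + 2) : (ZMod n)ˣ) : ZMod n) =
    diffCount α ((α ^ j : (ZMod n)ˣ) : ZMod n) := by
  rw [← diffCount_neg ((α ^ j : (ZMod n)ˣ) : ZMod n)]
  exact (diffCount_of_mem hn hα ((neg_mem_cycClass_iff hn hα).mpr (gen_pow_mem j))).symm

include hn hα in
theorem diffCount_zero : diffCount α 0 = (n - 1) / 4 := by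
  classical
  rw [← card_cycClass hn hα 0, diffCount]
  congr 1; ext x; simp

include hn hα in
/-- Sums weighted by difference counts, class by class. -/
theorem sum_diffCount_mul {R : Type*} [CommRing R] (g : ZMod n → R) :
    ∑ t, (diffCount α t : R) * g t = ((n - 1) / 4 : ℕ) * g 0 +
      (diffCount α 1 * (∑ x ∈ cycClass α 4 0, g x + ∑ x ∈ cycClass α 4 2, g x) +
       diffCount α α * (∑ x ∈ cycClass α 4 1, g x + ∑ x ∈ cycClass α 4 3, g x)) := by
  have h : ∀ j, ∑ t ∈ cycClass α 4 j, (diffCount α t : R) * g t =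
      diffCount α ((α ^ j : (ZMod n)ˣ) : ZMod n) * ∑ t ∈ cycClass α 4 j, g t := by
    intro j
    rw [Finset.mul_sum]
    exact Finset.sum_congr rfl fun t ht => by rw [diffCount_of_mem hn hα ht]
  rw [sum_eq_sum_cycClass hn hα, diffCount_zero hn hα]
  simp only [Finset.sum_range_succ, Finset.sum_range_zero, h, zero_add]
  rw [diffCount_gen_pow_add_two hn hα 1, show (2 : ℕ) = 0 + 2 from rfl,
    diffCount_gen_pow_add_two hn hα 0]
  simp only [pow_zero, pow_one, Units.val_one]
  ring

/-- Products of sums over `C₀`. -/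
theorem sum_mul_sum_cycClass {R : Type*} [CommRing R] (ψ : AddChar (ZMod n) R) (a : ZMod n) :
    (∑ x ∈ cycClass α 4 0, ψ (a * x)) * ∑ y ∈ cycClass α 4 0, ψ (-a * y) =
      ∑ t, (diffCount α t : R) * ψ (a * t) := by
  classical
  simp only [diffCount, Finset.card_filter, Nat.cast_sum, Finset.sum_mul]
  rw [Finset.sum_comm, ← Finset.sum_subset (Finset.subset_univ (cycClass α 4 0))]
  · refine Finset.sum_congr rfl fun x hx => ?_
    rw [← Equiv.sum_comp (Equiv.subLeft x), Finset.mul_sum,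
      ← Finset.sum_subset (Finset.subset_univ (cycClass α 4 0))]
    · refine Finset.sum_congr rfl fun y hy => ?_
      rw [← AddChar.map_add_eq_mul]
      simp only [Equiv.subLeft_apply, sub_sub_cancel, hx, hy, and_self, if_true, Nat.cast_one,
        one_mul]
      congr 1; ring
    · intro y _ hy
      simp [hy]
  · intro x _ hx
    simp [hx]

include hn hα in
-- All f² pairs in C₀ × C₀ sorted by their difference, which is the product formula for the trivial
-- character; a factor f cancels.
theorem one_add_two_mul_diffCount : 1 + 2 * (diffCount α 1 + diffCount α α) = (n - 1) / 4 := by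
  have h1 := sum_mul_sum_cycClass (α := α) (1 : AddChar (ZMod n) ℤ) 0
  have h2 := sum_diffCount_mul hn hα (fun t => (1 : AddChar (ZMod n) ℤ) (0 * t))
  rw [← h1] at h2
  simp only [AddChar.one_apply, Finset.sum_const, card_cycClass hn hα, nsmul_eq_mul, mul_one] at h2
  have hpos : 0 < (n - 1) / 4 := by have : n % 8 = 5 := hn; omega
  set f := (n - 1) / 4
  have : (f : ℤ) * f = f * (1 + 2 * (diffCount α 1 + diffCount α α)) := by rw [h2]; ring
  have := mul_left_cancel₀ (by exact_mod_cast hpos.ne') this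
  exact_mod_cast this.symm

end CyclotomicNumbers

/-! ### Products of Gaussian periods -/

section Periods

variable {n : ℕ} [Fact n.Prime] {α : (ZMod n)ˣ} {L : Type*} [Field L] {η : L}
variable (hn : n ≡ 5 [MOD 8]) (hα : ∀ x, x ∈ Subgroup.zpowers α)

include hn hα in
theorem sum_rootChar_mul (hη : IsPrimitiveRoot η n) {a : ZMod n} {j : ℕ} (ha : a ∈ cycClass α 4 j)
    (i : ℕ) : ∑ x ∈ cycClass α 4 i, rootChar hη (a * x) = etaSum α η (j + i) := by
  rw [sum_cycClass_mul hn hα _ ha]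
  simp only [rootChar_apply, etaSum]

include hn hα in
theorem etaSum_add_four (i : ℕ) : etaSum α η (i + 4) = etaSum α η i := by
  rw [etaSum, etaSum, cycClass_congr hn hα (i := i + 4) (j := i) (by simp [Nat.ModEq])]

include hn hα in
theorem sum_etaSum (hη : IsPrimitiveRoot η n) :
    etaSum α η 0 + etaSum α η 1 + etaSum α η 2 + etaSum α η 3 = -1 := by
  have h := sum_eq_sum_cycClass hn hα (fun a => rootChar hη a)
  have h0 := AddChar.sum_mulShift (1 : ZMod n) (rootChar_isPrimitive hη)
  simp only [mul_one, one_ne_zero, if_false, Nat.cast_zero] at h0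
  rw [h0] at h
  simp only [AddChar.map_zero_eq_one, Finset.sum_range_succ, Finset.sum_range_zero, zero_add] at h
  simp only [etaSum, ← rootChar_apply hη]
  linear_combination -h

include hn hα in
-- Because C_{j+2} = -C_j, the product is a character sum over the differences of C₀, scaled by α^j.
theorem etaSum_mul (hη : IsPrimitiveRoot η n) (j : ℕ) :
    etaSum α η j * etaSum α η (j + 2) = ((n - 1) / 4 : ℕ) +
      (diffCount α 1 * (etaSum α η j + etaSum α η (j + 2)) +
       diffCount α α * (etaSum α η (j + 1) + etaSum α η (j + 3))) := by
  have ha := gen_pow_mem (α := α) j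
  have h1 := sum_mul_sum_cycClass (α := α) (rootChar hη) ((α ^ j : (ZMod n)ˣ) : ZMod n)
  rw [sum_diffCount_mul hn hα] at h1
  simp only [sum_rootChar_mul hn hα hη ha,
    sum_rootChar_mul hn hα hη ((neg_mem_cycClass_iff hn hα).mpr ha), mul_zero,
    AddChar.map_zero_eq_one, mul_one, add_zero] at h1
  exact h1

end Periods

/-! ### First and second moments of value counts in a shift-invariant code -/

section Moments

variable {n : ℕ} [Fact n.Prime] {K : Type*} [Field K]

/-- A word with `c(i + t) = μ c(i)` is determined by `c(0)`. -/
theorem apply_mul_of_shift {c : ZMod n → K} {t : ZMod n} {μ : K} (h : ∀ i, c (i + t) = μ * c i)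
    (k : ℕ) (i : ZMod n) : c (i + k * t) = μ ^ k * c i := by
  induction k with
  | zero => simp
  | succ k ih =>
    rw [Nat.cast_succ, add_mul, one_mul, ← add_assoc, h, ih, pow_succ]; ring

theorem apply_of_shift {c : ZMod n → K} {t : ZMod n} (ht : t ≠ 0) {μ : K}
    (h : ∀ i, c (i + t) = μ * c i) (i : ZMod n) : c i = μ ^ (i * t⁻¹).val * c 0 := by
  rw [← apply_mul_of_shift h, ZMod.natCast_zmod_val, mul_assoc, inv_mul_cancel₀ ht, mul_one,
    zero_add]

/-- A shift-invariant code. -/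
def IsShiftInvariant (V : Submodule K (ZMod n → K)) : Prop :=
  ∀ c ∈ V, ∀ δ : ZMod n, (fun i => c (i + δ)) ∈ V

/-- As n is prime, t generates ℤ/n and the coordinate at 0 determines the word. -/
theorem finrank_le_one_of_shift {V : Submodule K (ZMod n → K)} {t : ZMod n} (ht : t ≠ 0) {μ : K}
    (h : ∀ c ∈ V, ∀ i, c (i + t) = μ * c i) : Module.finrank K V ≤ 1 := by
  have hinj : Function.Injective ((LinearMap.proj (0 : ZMod n) : (ZMod n → K) →ₗ[K] K) ∘ₗ V.subtype) := by
    rw [← LinearMap.ker_eq_bot, LinearMap.ker_eq_bot']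
    rintro ⟨c, hc⟩ h0
    ext i
    simp only [LinearMap.comp_apply, Submodule.subtype_apply, LinearMap.proj_apply] at h0
    simp [apply_of_shift ht (h c hc) i, h0]
  simpa using LinearMap.finrank_le_finrank_of_injective hinj

/-- Distinct coordinates of a shift-invariant code of dimension at least two are independent. -/
theorem pair_surjective {V : Submodule K (ZMod n → K)} (hV : IsShiftInvariant V)
    (hdim : 2 ≤ Module.finrank K V) {i j : ZMod n} (hij : i ≠ j) :
    Function.Surjective
      (((LinearMap.proj i : (ZMod n → K) →ₗ[K] K).prod (LinearMap.proj j)) ∘ₗ V.subtype) := by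
  rw [← LinearMap.range_eq_top]
  by_contra hne
  -- A missing pair of values yields one linear relation between the two coordinates, and shift
  -- invariance spreads it over the whole word. It then either annihilates V or is a geometric
  -- recurrence, so that dim V ≤ 1.
  obtain ⟨φ, hφ, hle⟩ := Submodule.exists_le_ker_of_lt_top _ (lt_top_iff_ne_top.mpr hne)
  set a := φ (1, 0)
  set b := φ (0, 1)
  have hφe : ∀ x y, φ (x, y) = x * a + y * b := by
    intro x y
    have : ((x, y) : K × K) = x • (1, 0) + y • (0, 1) := by simp
    rw [this, map_add, map_smul, map_smul, smul_eq_mul, smul_eq_mul]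
  have hrel : ∀ c ∈ V, ∀ δ, c (i + δ) * a + c (j + δ) * b = 0 := by
    intro c hc δ
    rw [← hφe]
    exact hle ⟨⟨_, hV c hc δ⟩, rfl⟩
  have hbot : ∀ (k : ZMod n), (∀ c ∈ V, ∀ δ, c (k + δ) = 0) → False := by
    intro k h
    have : V = ⊥ := by
      rw [Submodule.eq_bot_iff]
      intro c hc
      ext x
      have := h c hc (x - k)
      rwa [add_sub_cancel] at this
    rw [this, finrank_bot] at hdim
    omega
  by_cases hb : b = 0
  · by_cases ha : a = 0
    · exact hφ (LinearMap.ext fun ⟨x, y⟩ => by rw [hφe, ha, hb]; simp)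
    · exact hbot i fun c hc δ => by
        have := hrel c hc δ
        rw [hb, mul_zero, add_zero] at this
        exact (mul_eq_zero.mp this).resolve_right ha
  · have := finrank_le_one_of_shift (V := V) (t := j - i) (sub_ne_zero.mpr hij.symm)
      (μ := -a * b⁻¹) fun c hc x => by
        have := hrel c hc (x - i)
        rw [add_sub_cancel, show j + (x - i) = x + (j - i) by ring] at this
        field_simp
        linear_combination this
    omega

variable [Fintype K]

omit [Fintype K] in
/-- Fibres of a surjective linear map between finite modules. -/
theorem card_fiber_mul {V W : Type*} [AddCommGroup V] [AddCommGroup W] [Module K V] [Module K W]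
    [Fintype V] [Fintype W] [DecidableEq W] (φ : V →ₗ[K] W) (hφ : Function.Surjective φ) (w : W) :
    (Finset.univ.filter fun v => φ v = w).card * Fintype.card W = Fintype.card V := by
  have h : ∀ w', (Finset.univ.filter fun v => φ v = w').card =
      (Finset.univ.filter fun v => φ v = w).card := by
    intro w'
    obtain ⟨d, hd⟩ := hφ (w - w')
    refine Finset.card_nbij' (fun v => v + d) (fun v => v - d) ?_ ?_ ?_ ?_
    · intro v hv; simp at hv ⊢; rw [hv, hd]; abel
    · intro v hv; simp at hv ⊢; rw [hv, hd]; abel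
    · intro v _; simp
    · intro v _; simp
  have h1 := Finset.card_eq_sum_card_fiberwise (f := φ) (s := Finset.univ) (t := Finset.univ)
    (by simp)
  simp only [h, Finset.sum_const, Finset.card_univ, smul_eq_mul] at h1
  rw [h1, mul_comm]

open Classical in
/-- The deviation `q · #{i : c_i = a} - n`. -/
def deviation (a : K) (c : ZMod n → K) : ℝ :=
  Fintype.card K * (Finset.univ.filter fun i => c i = a).card - n

open Classical in
theorem card_mul_sum_coord {V : Submodule K (ZMod n → K)} (hV : IsShiftInvariant V)
    (hdim : 2 ≤ Module.finrank K V) (a : K) (i : ZMod n) : (Fintype.card K : ℝ) *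
      ∑ c : V, (if c.1 i = a then (1 : ℝ) else 0) = Fintype.card V := by
  have hs : Function.Surjective ((LinearMap.proj i : (ZMod n → K) →ₗ[K] K) ∘ₗ V.subtype) := by
    obtain ⟨j, hj⟩ := exists_ne i
    intro x
    obtain ⟨c, hc⟩ := pair_surjective hV hdim hj.symm (x, 0)
    exact ⟨c, congrArg Prod.fst hc⟩
  have := card_fiber_mul _ hs a
  rw [← this, Finset.card_filter]
  push_cast
  rw [mul_comm]; rfl

open Classical in
theorem sum_deviation {V : Submodule K (ZMod n → K)} (hV : IsShiftInvariant V)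
    (hdim : 2 ≤ Module.finrank K V) (a : K) : ∑ c : V, deviation a c.1 = 0 := by
  have h1 := card_mul_sum_coord hV hdim a
  simp only [deviation, Finset.card_filter, Nat.cast_sum, Finset.sum_sub_distrib, ← Finset.mul_sum]
  rw [Finset.sum_comm, Finset.mul_sum]
  push_cast
  simp only [h1]
  simp [mul_comm]

open Classical in
-- Coordinates are uniform and pairwise independent, so the variance of the count is the sum of the
-- n single variances.
theorem sum_deviation_sq {V : Submodule K (ZMod n → K)} (hV : IsShiftInvariant V)
    (hdim : 2 ≤ Module.finrank K V) (a : K) :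
    ∑ c : V, deviation a c.1 ^ 2 = n * Fintype.card V * (Fintype.card K - 1) := by
  set q : ℝ := (Fintype.card K : ℝ)
  set r : ℝ := (Fintype.card V : ℝ)
  have h2 : ∀ i j : ZMod n, q ^ 2 *
      ∑ c : V, (if c.1 i = a then (1 : ℝ) else 0) * (if c.1 j = a then (1 : ℝ) else 0) =
        r + if i = j then r * (q - 1) else 0 := by
    intro i j
    by_cases hij : i = j
    · subst hij
      have h := card_mul_sum_coord hV hdim a i
      simp only [← ite_and, mul_ite, mul_one, mul_zero, and_self, if_true] at h ⊢
      rw [sq, mul_assoc, h]; ring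
    · have h := card_fiber_mul _ (pair_surjective hV hdim hij) (a, a)
      rw [if_neg hij, add_zero]
      simp only [r]
      rw [← h, Finset.card_filter, Fintype.card_prod]
      push_cast
      rw [mul_comm, ← sq]
      congr 1
      refine Finset.sum_congr rfl fun c _ => ?_
      change _ = if ((c.1 i, c.1 j) : K × K) = (a, a) then (1 : ℝ) else 0
      by_cases h1 : c.1 i = a <;> by_cases h2 : c.1 j = a <;> simp [h1, h2]
  have h0 := sum_deviation hV hdim a
  have hz : ∀ c : V, deviation a c.1 ^ 2 =
      q ^ 2 * (∑ i, ∑ j, (if c.1 i = a then (1 : ℝ) else 0) * (if c.1 j = a then (1 : ℝ) else 0))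
        - 2 * n * deviation a c.1 - n ^ 2 := by
    intro c
    rw [← Finset.sum_mul_sum]
    simp only [deviation, Finset.card_filter, Nat.cast_sum]
    push_cast
    ring
  simp only [hz, Finset.sum_sub_distrib, ← Finset.mul_sum]
  have h3 : q ^ 2 * ∑ c : V, ∑ i, ∑ j, (if c.1 i = a then (1 : ℝ) else 0) *
      (if c.1 j = a then (1 : ℝ) else 0) = n ^ 2 * r + n * (r * (q - 1)) := by
    rw [Finset.sum_comm, Finset.mul_sum]
    have : ∀ i : ZMod n, q ^ 2 * ∑ c : V, ∑ j, (if c.1 i = a then (1 : ℝ) else 0) *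
        (if c.1 j = a then (1 : ℝ) else 0) = n * r + r * (q - 1) := by
      intro i
      rw [Finset.sum_comm, Finset.mul_sum]
      simp only [h2]
      simp [Finset.sum_add_distrib, ZMod.card]
    simp only [this]
    simp only [Finset.sum_const, Finset.card_univ, ZMod.card, nsmul_eq_mul]
    ring
  simp only [← Finset.mul_sum] at h3
  rw [h0, h3]
  simp only [Finset.sum_const, Finset.card_univ, nsmul_eq_mul]
  ring

/-- Cauchy–Schwarz outside a set on which `E` is constant. -/
theorem sq_sum_sub_le {ι : Type*} [DecidableEq ι] {T O : Finset ι} (hO : O ⊆ T) {E : ι → ℝ} {e : ℝ}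
    (he : ∀ x ∈ O, E x = e) : (∑ x ∈ T, E x - O.card * e) ^ 2 ≤
      (T.card - O.card) * (∑ x ∈ T, E x ^ 2 - O.card * e ^ 2) := by
  have h := sq_sum_le_card_mul_sum_sq (s := T \ O) (f := E)
  have h1 := Finset.sum_sdiff hO (f := E)
  have h2 := Finset.sum_sdiff hO (f := fun x => E x ^ 2)
  have e1 : ∑ x ∈ O, E x = O.card * e := by
    rw [Finset.sum_congr rfl he, Finset.sum_const, nsmul_eq_mul]
  have e2 : ∑ x ∈ O, E x ^ 2 = O.card * e ^ 2 := by
    rw [Finset.sum_congr rfl fun x hx => by rw [he x hx], Finset.sum_const, nsmul_eq_mul]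
  rw [e1] at h1
  rw [e2] at h2
  rw [← h1, ← h2, ← Nat.cast_sub (Finset.card_le_card hO), ← Finset.card_sdiff_of_subset hO]
  simpa using h

theorem deviation_congr {a a' : K} {c c' : ZMod n → K} (σ : ZMod n ≃ ZMod n)
    (h : ∀ i, c' i = a' ↔ c (σ i) = a) : deviation a' c' = deviation a c := by
  classical
  unfold deviation
  congr 3
  refine Finset.card_nbij' σ σ.symm ?_ ?_ ?_ ?_ <;> intro i hi <;> simp_all

/-- For the value 0 scalars also preserve the count. The orbits used then have n(q-1) words, against
n for a nonzero value, which sharpens the bound. -/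
theorem deviation_twist (c : ZMod n → K) (δ : ZMod n) (ν : Kˣ) :
    deviation 0 (fun i => (ν : K) * c (i + δ)) = deviation 0 c :=
  deviation_congr (Equiv.addRight δ) fun i => by simp

theorem deviation_shift (a : K) (c : ZMod n → K) (δ : ZMod n) :
    deviation a (fun i => c (i + δ)) = deviation a c :=
  deviation_congr (Equiv.addRight δ) fun i => by simp

theorem deviation_zero_zero : deviation (0 : K) (0 : ZMod n → K) = n * (Fintype.card K - 1) := by
  simp [deviation, ZMod.card]; ring

theorem deviation_ne_zero {a : K} (ha : a ≠ 0) : deviation a (0 : ZMod n → K) = -n := by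
  simp [deviation, ha.symm]

/-- A nonzero word with zero coordinate sum is not proportional to any of its proper shifts. -/
theorem twist_injective (hnK : (n : K) ≠ 0) (hcop : n.Coprime (Fintype.card K - 1))
    {c : ZMod n → K} (hc : c ≠ 0) (hs : ∑ i, c i = 0) :
    Function.Injective fun (x : ZMod n × Kˣ) (i : ZMod n) => (x.2 : K) * c (i + x.1) := by
  rintro ⟨δ, ν⟩ ⟨δ', ν'⟩ h
  obtain ⟨i₀, hi₀⟩ := Function.ne_iff.mp hc
  have hδ : δ = δ' := by
    by_contra hne
    have ht : δ - δ' ≠ 0 := sub_ne_zero.mpr hne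
    have hrec : ∀ i, c (i + (δ - δ')) = ((ν' / ν : Kˣ) : K) * c i := by
      intro i
      have h1 := congrFun h (i - δ')
      simp only [sub_add_cancel] at h1
      rw [Units.val_div_eq_div_val, div_mul_eq_mul_div, eq_div_iff (Units.ne_zero ν), ← h1, mul_comm]
      congr 2; ring
    -- Shifting n times returns to the start, so the ratio is an n-th root of unity in K; as n is
    -- coprime to q - 1 it is 1. The word would then be constant, contradicting its zero sum.
    have hpow : ((ν' / ν : Kˣ) : K) ^ n = 1 := by
      have h1 := apply_mul_of_shift hrec n i₀
      rw [ZMod.natCast_self, zero_mul, add_zero] at h1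
      exact mul_right_cancel₀ hi₀ (h1.symm.trans (one_mul _).symm)
    have hone : (ν' / ν : Kˣ) = 1 := by
      have h1 : (ν' / ν : Kˣ) ^ n = 1 := Units.ext (by simpa using hpow)
      have h2 : (ν' / ν : Kˣ) ^ (Fintype.card K - 1) = 1 := by
        classical
        rw [← Fintype.card_units]; exact pow_card_eq_one
      have := pow_gcd_eq_one.mpr ⟨h1, h2⟩
      rwa [hcop.gcd_eq_one, pow_one] at this
    rw [hone] at hrec
    have hconst : ∀ i, c i = c 0 := fun i => by
      have := apply_of_shift ht hrec i
      simpa using this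
    rw [Finset.sum_congr rfl fun i _ => hconst i] at hs
    simp only [Finset.sum_const, Finset.card_univ, ZMod.card, nsmul_eq_mul] at hs
    exact hi₀ ((hconst i₀).trans ((mul_eq_zero.mp hs).resolve_left hnK))
  subst hδ
  have h1 := congrFun h (i₀ - δ)
  simp only [sub_add_cancel] at h1
  rw [Units.ext (mul_right_cancel₀ hi₀ h1)]

/-- Cauchy–Schwarz over the nonzero words outside the image of g. The two moments over V are known,
so the zero word and the words g x are subtracted from them. -/
theorem orbit_bound {V : Submodule K (ZMod n → K)} (hV : IsShiftInvariant V)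
    (hdim : 2 ≤ Module.finrank K V) (a : K) {ι : Type*} [Fintype ι] (g : ι → ZMod n → K)
    (hg : Function.Injective g) (hgV : ∀ x, g x ∈ V) (hg0 : ∀ x, g x ≠ 0) {e : ℝ}
    (he : ∀ x, deviation a (g x) = e) :
    (-deviation a (0 : ZMod n → K) - Fintype.card ι * e) ^ 2 ≤
      ((Fintype.card K : ℝ) ^ Module.finrank K V - 1 - Fintype.card ι) *
        (n * (Fintype.card K : ℝ) ^ Module.finrank K V * (Fintype.card K - 1) -
          deviation a (0 : ZMod n → K) ^ 2 - Fintype.card ι * e ^ 2) ∧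
    (Fintype.card ι : ℝ) ≤ (Fintype.card K : ℝ) ^ Module.finrank K V - 1 := by
  classical
  let g' : ι ↪ V := ⟨fun x => ⟨g x, hgV x⟩, fun x y h => hg (congrArg Subtype.val h)⟩
  set O : Finset V := Finset.univ.map g'
  have hO : O ⊆ Finset.univ.erase 0 := by
    intro c hc
    obtain ⟨x, -, rfl⟩ := Finset.mem_map.mp hc
    refine Finset.mem_erase.mpr ⟨fun h => hg0 x (congrArg Subtype.val h), Finset.mem_univ _⟩
  have hOc : O.card = Fintype.card ι := by rw [Finset.card_map, Finset.card_univ]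
  have hr : (Fintype.card V : ℝ) = (Fintype.card K : ℝ) ^ Module.finrank K V := by
    rw [Module.card_eq_pow_finrank (K := K) (V := V)]; push_cast; rfl
  have hTc : ((Finset.univ.erase (0 : V)).card : ℝ) =
      (Fintype.card K : ℝ) ^ Module.finrank K V - 1 := by
    rw [Finset.card_erase_of_mem (Finset.mem_univ _), Finset.card_univ,
      Nat.cast_sub Fintype.card_pos, hr, Nat.cast_one]
  have key := sq_sum_sub_le hO (E := fun c : V => deviation a c.1) (e := e) (by
    intro c hc
    obtain ⟨x, -, rfl⟩ := Finset.mem_map.mp hc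
    exact he x)
  have s1 := Finset.sum_erase_add Finset.univ (fun c : V => deviation a c.1) (Finset.mem_univ 0)
  have s2 := Finset.sum_erase_add Finset.univ (fun c : V => deviation a c.1 ^ 2) (Finset.mem_univ 0)
  rw [sum_deviation hV hdim] at s1
  rw [sum_deviation_sq hV hdim, hr] at s2
  rw [eq_neg_of_add_eq_zero_left s1, eq_sub_of_add_eq s2, hOc, hTc] at key
  refine ⟨key, ?_⟩
  rw [← hTc, ← hOc]
  exact_mod_cast Finset.card_le_card hO

/-- The bound for the number of zeros of a word of a cyclic code of dimension at least two. -/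
theorem deviation_zero_bound {V : Submodule K (ZMod n → K)} (hV : IsShiftInvariant V)
    (hdim : 2 ≤ Module.finrank K V) (hnK : (n : K) ≠ 0) (hcop : n.Coprime (Fintype.card K - 1))
    (hs : ∀ c ∈ V, ∑ i, c i = 0) {c : ZMod n → K} (hcV : c ∈ V) (hc : c ≠ 0) {r N₁ : ℝ}
    (hr : r = (Fintype.card K : ℝ) ^ Module.finrank K V)
    (hN : N₁ * (n * (Fintype.card K - 1)) = r - 1) :
    1 ≤ N₁ ∧ (N₁ * deviation 0 c + 1) ^ 2 ≤ r * (N₁ - 1) ^ 2 := by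
  classical
  have hinj := twist_injective hnK hcop hc (hs c hcV)
  obtain ⟨h1, h2⟩ := orbit_bound hV hdim 0
    (fun (x : ZMod n × Kˣ) (i : ZMod n) => (x.2 : K) * c (i + x.1)) hinj
    (fun x => V.smul_mem _ (hV c hcV x.1))
    (fun x h => hc (by
      ext i
      have := congrFun h (i - x.1)
      simpa using this))
    (fun x => deviation_twist c x.1 x.2)
  have hcard : (Fintype.card (ZMod n × Kˣ) : ℝ) = n * (Fintype.card K - 1) := by
    rw [Fintype.card_prod, ZMod.card, Fintype.card_units, Nat.cast_mul,
      Nat.cast_sub Fintype.card_pos, Nat.cast_one]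
  rw [hcard, deviation_zero_zero, ← hr] at h1
  rw [hcard, ← hr] at h2
  set q : ℝ := (Fintype.card K : ℝ)
  have hq : 1 < q := Nat.one_lt_cast.mpr Fintype.one_lt_card
  have hn0 : (0 : ℝ) < n := by exact_mod_cast (Fact.out : n.Prime).pos
  have hM : 0 < n * (q - 1) := by nlinarith
  set M := (n : ℝ) * (q - 1)
  set e := deviation 0 c
  have hN1 : 1 ≤ N₁ := by
    by_contra h
    nlinarith
  refine ⟨hN1, ?_⟩
  have h3 : M * (M * (1 + e) ^ 2) ≤ M * (M * ((N₁ - 1) * (r - M - e ^ 2))) := by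
    calc M * (M * (1 + e) ^ 2) = (-M - M * e) ^ 2 := by ring
      _ ≤ _ := h1
      _ = M * (M * ((N₁ - 1) * (r - M - e ^ 2))) := by
        rw [show (n : ℝ) * r * (q - 1) = M * r by simp only [M]; ring, ← hN]; ring
  -- This reads (1+e)² ≤ (N₁-1)(r-M-e²). Multiplying by N₁ and using N₁M = r-1 completes the square
  -- in e.
  have h4 := le_of_mul_le_mul_left (le_of_mul_le_mul_left h3 hM) hM
  have h5 := mul_le_mul_of_nonneg_left h4 (by linarith : 0 ≤ N₁)
  nlinarith

/-- The bound for the number of coordinates of a word equal to a given nonzero element. -/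
theorem deviation_ne_zero_bound {V : Submodule K (ZMod n → K)} (hV : IsShiftInvariant V)
    (hdim : 2 ≤ Module.finrank K V) (hnK : (n : K) ≠ 0) (hcop : n.Coprime (Fintype.card K - 1))
    (hs : ∀ c ∈ V, ∑ i, c i = 0) {c : ZMod n → K} (hcV : c ∈ V) (hc : c ≠ 0) {a : K} (ha : a ≠ 0)
    {r N : ℝ} (hr : r = (Fintype.card K : ℝ) ^ Module.finrank K V) (hN : N * n = r - 1) :
    1 ≤ N ∧
      (N * deviation a c - 1) ^ 2 ≤ (N - 1) * r * (N * (Fintype.card K - 1) - 1) := by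
  classical
  have hinj : Function.Injective fun (δ : ZMod n) (i : ZMod n) => c (i + δ) := by
    intro δ δ' h
    have := twist_injective hnK hcop hc (hs c hcV) (a₁ := (δ, 1)) (a₂ := (δ', 1)) (by
      ext i; simpa using congrFun h i)
    exact congrArg Prod.fst this
  obtain ⟨h1, h2⟩ := orbit_bound hV hdim a (fun (δ : ZMod n) (i : ZMod n) => c (i + δ)) hinj
    (fun δ => hV c hcV δ)
    (fun δ h => hc (by
      ext i
      have := congrFun h (i - δ)
      simpa using this))
    (fun δ => deviation_shift a c δ)
  rw [ZMod.card, deviation_ne_zero ha, ← hr] at h1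
  rw [ZMod.card, ← hr] at h2
  set q : ℝ := (Fintype.card K : ℝ)
  have hn0 : (0 : ℝ) < n := by exact_mod_cast (Fact.out : n.Prime).pos
  set e := deviation a c
  have hN1 : 1 ≤ N := by
    by_contra h
    nlinarith
  refine ⟨hN1, ?_⟩
  have h3 : n * (n * (1 - e) ^ 2) ≤ n * (n * ((N - 1) * (r * (q - 1) - n - e ^ 2))) := by
    calc n * (n * (1 - e) ^ 2) = (- -(n : ℝ) - n * e) ^ 2 := by ring
      _ ≤ _ := h1
      _ = n * (n * ((N - 1) * (r * (q - 1) - n - e ^ 2))) := by rw [← hN]; ring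
  -- Again multiplication by N, now with Nn = r-1, completes the square in e.
  have h4 := le_of_mul_le_mul_left (le_of_mul_le_mul_left h3 hn0) hn0
  have h5 := mul_le_mul_of_nonneg_left h4 (by linarith : 0 ≤ N)
  nlinarith

end Moments

/-! ### Codes with prescribed spectrum and the bounds 𝓑₁ and 𝓑₂ -/

section SpectralCodes

variable {n : ℕ} [Fact n.Prime] {K L : Type*} [Field K] [Field L] [Algebra K L] {η : L}

/-- The words over `K` whose transform is supported on `Z`. -/
def specCode (K : Type*) [Field K] [Algebra K L] (hη : IsPrimitiveRoot η n) (Z : Finset (ZMod n)) :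
    Submodule K (ZMod n → K) where
  carrier := {c | ∀ a ∉ Z, wdft hη c a = 0}
  zero_mem' := by intro a _; simp [wdft, dft]
  add_mem' := by
    intro c c' hc hc' a ha
    have h1 := hc a ha
    have h2 := hc' a ha
    simp only [wdft, dft] at h1 h2 ⊢
    simp only [Pi.add_apply, map_add, add_mul, Finset.sum_add_distrib, h1, h2, add_zero]
  smul_mem' := by
    intro x c hc a ha
    have h1 := hc a ha
    simp only [wdft, dft] at h1 ⊢
    simp only [Pi.smul_apply, smul_eq_mul, map_mul, mul_assoc, ← Finset.mul_sum, h1, mul_zero]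

theorem specCode_isShiftInvariant (hη : IsPrimitiveRoot η n) (Z : Finset (ZMod n)) :
    IsShiftInvariant (specCode K hη Z) := by
  intro c hc δ a ha
  have := dft_addShift (rootChar hη) (fun i => algebraMap K L (c i)) δ a
  rw [wdft, this, show dft (rootChar hη) (fun i => algebraMap K L (c i)) a = 0 from hc a ha,
    mul_zero]

theorem wdft_zero (hη : IsPrimitiveRoot η n) (c : ZMod n → K) :
    wdft hη c 0 = algebraMap K L (∑ i, c i) := by
  rw [wdft, dft_zero, map_sum]

theorem sum_eq_zero_of_mem_specCode {hη : IsPrimitiveRoot η n} {Z : Finset (ZMod n)} (h0 : 0 ∉ Z)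
    {c : ZMod n → K} (hc : c ∈ specCode K hη Z) : ∑ i, c i = 0 := by
  have := hc 0 h0
  rw [wdft_zero] at this
  exact (map_eq_zero _).mp this

theorem sum_rootChar (hη : IsPrimitiveRoot η n) {a : ZMod n} (ha : a ≠ 0) :
    ∑ i, rootChar hη (a * i) = 0 := by
  have := AddChar.sum_mulShift a (rootChar_isPrimitive hη)
  simpa [ha, mul_comm] using this

theorem const_mem_specCode (hη : IsPrimitiveRoot η n) {Z : Finset (ZMod n)} (h0 : 0 ∈ Z) (x : K) :
    (fun _ => x) ∈ specCode K hη Z := by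
  intro a ha
  rw [wdft, dft, ← Finset.mul_sum, sum_rootChar hη (by rintro rfl; exact ha h0), mul_zero]

theorem hammingNorm_algebraMap [DecidableEq K] [DecidableEq L] (c : ZMod n → K) :
    hammingNorm (fun i => algebraMap K L (c i)) = hammingNorm c := by
  simp [hammingNorm]

open Classical in
theorem exists_hammingNorm_eq_minWeight {D : Submodule K (Fin n → K)} (hD : D ≠ ⊥) :
    ∃ c ∈ D, toZMod K n c ≠ 0 ∧ hammingNorm (toZMod K n c) = minWeight D := by
  obtain ⟨c, hc, hc0⟩ := Submodule.exists_mem_ne_zero_of_ne_bot hD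
  obtain ⟨c', hc', hc0', hw⟩ := Nat.sInf_mem
    (s := {w : ℕ | ∃ c ∈ D, c ≠ 0 ∧ hammingNorm c = w}) ⟨_, c, hc, hc0, rfl⟩
  refine ⟨c', hc', fun h => hc0' ((toZMod K n).map_eq_zero_iff.mp h), ?_⟩
  rw [hammingNorm_toZMod]
  exact hw

theorem deviation_eq [Fintype K] [DecidableEq K] (c : ZMod n → K) :
    deviation 0 c = Fintype.card K * (n - hammingNorm c) - n := by
  have h := Finset.card_filter_add_card_filter_not (s := (Finset.univ : Finset (ZMod n)))
    (fun i => c i = 0)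
  rw [Finset.card_univ, ZMod.card] at h
  have h' : (hammingNorm c : ℝ) = n - (Finset.univ.filter fun i => c i = 0).card := by
    rw [eq_sub_iff_add_eq, add_comm]
    exact_mod_cast h
  rw [h', deviation]
  congr 2
  rw [sub_sub_cancel]
  congr!

variable [Fintype K]

/-- The arithmetic of a length `n` coprime to `q - 1` with `q` of order `k` modulo `n`. -/
theorem orbit_length_dvd {q k : ℕ} (hq : 1 ≤ q) (hord : orderOf (q : ZMod n) = k) (hk : 2 ≤ k) :
    n.Coprime (q - 1) ∧ n * (q - 1) ∣ q ^ k - 1 := by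
  have hcop : n.Coprime (q - 1) := by
    rw [Nat.Prime.coprime_iff_not_dvd Fact.out]
    intro h
    rw [← ZMod.natCast_eq_zero_iff, Nat.cast_sub hq, sub_eq_zero, Nat.cast_one] at h
    rw [h, orderOf_one] at hord
    omega
  refine ⟨hcop, hcop.mul_dvd_of_dvd_of_dvd ?_ ?_⟩
  · rw [← ZMod.natCast_eq_zero_iff, Nat.cast_sub (Nat.one_le_pow _ _ hq), Nat.cast_pow, ← hord,
      pow_orderOf_eq_one]
    simp
  · simpa using Nat.sub_dvd_pow_sub_pow q 1 k

open Classical in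
-- With M = N₁ and e = q(n-w) - n, the quantity N₁e + 1 equals r - qMw, so the deviation bound
-- becomes r - qMw ≤ (M-1)√r.
theorem irrBound_le {V : Submodule K (ZMod n → K)} (hV : IsShiftInvariant V)
    (hdim : Module.finrank K V = (n - 1) / 4) (hk : 2 ≤ (n - 1) / 4) (hnK : (n : K) ≠ 0)
    (hord : orderOf (Fintype.card K : ZMod n) = (n - 1) / 4)
    (hs : ∀ c ∈ V, ∑ i, c i = 0) {c : ZMod n → K} (hcV : c ∈ V) (hc : c ≠ 0) :
    irrBound (Fintype.card K) n ≤ hammingNorm c := by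
  obtain ⟨hcop, M, hM⟩ := orbit_length_dvd Fintype.card_pos hord hk
  have hq1 : 1 < Fintype.card K := Fintype.one_lt_card
  have hn0 : (0 : ℝ) < n := by exact_mod_cast (Fact.out : n.Prime).pos
  set k := (n - 1) / 4 with hkdef
  set q := Fintype.card K
  have hq : (1 : ℝ) < q := by exact_mod_cast hq1
  have hr1 : (q : ℝ) ^ k - 1 = n * (q - 1) * M := by
    have : ((q ^ k - 1 : ℕ) : ℝ) = n * (q - 1 : ℕ) * M := by rw [hM]; push_cast; ring
    rwa [Nat.cast_sub (Nat.one_le_pow _ _ hq1.le), Nat.cast_sub hq1.le, Nat.cast_pow,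
      Nat.cast_one] at this
  obtain ⟨h1, h2⟩ := deviation_zero_bound hV (by omega) hnK hcop hs hcV hc
    (r := (q : ℝ) ^ k) (N₁ := M) (by rw [hdim]) (by rw [hr1]; ring)
  rw [deviation_eq] at h2
  set w : ℕ := hammingNorm c
  have hpos : (0 : ℝ) ≤ q ^ k := by positivity
  have hN : ((q : ℝ) ^ k - 1) / n = (q - 1) * M := by rw [hr1]; field_simp
  have hN1 : ((q : ℝ) - 1) * M / (q - 1) = M := by
    rw [mul_comm, mul_div_assoc, div_self (by linarith), mul_one]
  simp only [irrBound, ← hkdef, hN, hN1]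
  rw [Int.ceil_le, div_le_iff₀ (mul_pos (by linarith) (mul_pos (by linarith) (by linarith)))]
  have hle : (q : ℝ) ^ k - q * M * w ≤ (M - 1) * √((q : ℝ) ^ k) := by
    refine (abs_le_of_sq_le_sq' ?_ (mul_nonneg (by linarith) (Real.sqrt_nonneg _))).2
    rw [mul_pow, Real.sq_sqrt hpos, mul_comm _ ((q : ℝ) ^ k)]
    refine le_trans (le_of_eq ?_) h2
    rw [show (q : ℝ) ^ k = n * (q - 1) * M + 1 by linarith]
    ring
  -- The left side is an integer, as n(q-1) divides q^k - 1; hence the floor costs nothing.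
  have hfl : ((q : ℤ) ^ k - q * M * w) ≤ ⌊((M : ℝ) - 1) * √((q : ℝ) ^ k)⌋ := by
    rw [Int.le_floor]; push_cast; exact hle
  have hfl' : (q : ℝ) ^ k - q * M * w ≤ (⌊((M : ℝ) - 1) * √((q : ℝ) ^ k)⌋ : ℤ) := by
    exact_mod_cast hfl
  push_cast
  nlinarith

/-- The words of zero coordinate sum. -/
def sumZero (n : ℕ) [NeZero n] (K : Type*) [Field K] : Submodule K (ZMod n → K) :=
  LinearMap.ker (∑ i, LinearMap.proj i : (ZMod n → K) →ₗ[K] K)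

omit [Fintype K] in
theorem mem_sumZero {c : ZMod n → K} : c ∈ sumZero n K ↔ ∑ i, c i = 0 := by
  simp [sumZero, LinearMap.mem_ker]

omit [Fintype K] in
-- Since n ≠ 0 in K, the constants are a complement of the zero-sum words.
theorem finrank_inf_sumZero {V : Submodule K (ZMod n → K)} (hnK : (n : K) ≠ 0)
    (h1 : (fun _ => 1) ∈ V) :
    Module.finrank K (V ⊓ sumZero n K : Submodule K (ZMod n → K)) + 1 = Module.finrank K V := by
  have htop : V ⊔ sumZero n K = ⊤ := by
    rw [eq_top_iff]
    intro c _
    have : c = ((∑ i, c i) / n) • (fun _ => (1 : K)) + (c - ((∑ i, c i) / n) • fun _ => (1 : K)) := by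
      simp
    rw [this]
    refine Submodule.add_mem_sup (V.smul_mem _ h1) ?_
    rw [mem_sumZero]
    simp [ZMod.card]
    field_simp
    simp
  have hs := Submodule.finrank_sup_add_finrank_inf_eq V (sumZero n K)
  have hk := LinearMap.finrank_range_add_finrank_ker (∑ i, LinearMap.proj i : (ZMod n → K) →ₗ[K] K)
  have hr : LinearMap.range (∑ i, LinearMap.proj i : (ZMod n → K) →ₗ[K] K) = ⊤ := by
    rw [LinearMap.range_eq_top]
    intro x
    exact ⟨Pi.single 0 x, by simp⟩
  rw [hr, finrank_top, Module.finrank_self] at hk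
  rw [htop, finrank_top] at hs
  change 1 + Module.finrank K (sumZero n K) = _ at hk
  omega

open Classical in
-- Subtracting the mean b gives a zero-sum word c₀ with c = c₀ + b, and the zeros of c are the
-- coordinates where c₀ equals -b. The bounds for the value 0 (if b = 0) and for a nonzero value (if
-- b ≠ 0) apply to c₀; constant words are treated separately.
theorem augBound_le {V : Submodule K (ZMod n → K)} (hV : IsShiftInvariant V)
    (h1 : (fun _ => 1) ∈ V)
    (hdim : Module.finrank K V = (n - 1) / 4 + 1) (hk : 2 ≤ (n - 1) / 4) (hnK : (n : K) ≠ 0)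
    (hq3 : 3 ≤ Fintype.card K)
    (hord : orderOf (Fintype.card K : ZMod n) = (n - 1) / 4)
    {c : ZMod n → K} (hcV : c ∈ V) (hc : c ≠ 0) :
    augBound (Fintype.card K) n ≤ hammingNorm c := by
  obtain ⟨hcop, -⟩ := orbit_length_dvd Fintype.card_pos hord hk
  have hn0 : (0 : ℝ) < n := by exact_mod_cast (Fact.out : n.Prime).pos
  have hdim0 := finrank_inf_sumZero hnK h1
  set V₀ : Submodule K (ZMod n → K) := V ⊓ sumZero n K
  set k := (n - 1) / 4 with hkdef
  replace hdim0 : Module.finrank K V₀ = k := by omega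
  have hV₀ : IsShiftInvariant V₀ := fun c hc δ => ⟨hV c hc.1 δ, by
    have h2 := mem_sumZero.mp hc.2
    refine mem_sumZero.mpr ?_
    rw [← h2]
    exact Equiv.sum_comp (Equiv.addRight δ) c⟩
  have hs : ∀ c ∈ V₀, ∑ i, c i = 0 := fun c hc => mem_sumZero.mp hc.2
  have hdim2 : 2 ≤ Module.finrank K V₀ := by omega
  have hq : (3 : ℝ) ≤ (Fintype.card K : ℝ) := by exact_mod_cast hq3
  have hdev := deviation_eq c
  set w : ℕ := hammingNorm c
  set e := deviation 0 c
  have hcK : (Fintype.card K : ℝ) ^ Module.finrank K V₀ = (Fintype.card K : ℝ) ^ k := by rw [hdim0]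
  set q : ℝ := (Fintype.card K : ℝ)
  set r : ℝ := q ^ k with hr
  set N : ℝ := (r - 1) / n with hN
  have hNn : N * n = r - 1 := div_mul_cancel₀ _ hn0.ne'
  have hr0 : 0 ≤ r := pow_nonneg (by linarith) _
  have hN1n : N / (q - 1) * (n * (q - 1)) = r - 1 := by
    have : q - 1 ≠ 0 := by linarith
    rw [← hNn]; field_simp
  -- The n(q-1) twists of one nonzero word all lie among the r - 1 nonzero words.
  have hNq : q - 1 ≤ N := by
    obtain ⟨c', hc', hc0'⟩ := Submodule.exists_mem_ne_zero_of_ne_bot (p := V₀) (by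
      intro h
      rw [h, finrank_bot] at hdim2
      omega)
    have := (deviation_zero_bound hV₀ hdim2 hnK hcop hs hc' hc0' hcK.symm hN1n).1
    rwa [le_div_iff₀ (by linarith), one_mul] at this
  have hs0 := Real.sqrt_nonneg r
  have key : N * e - 1 ≤ (q - 1) * (N - 1) * √r := by
    set b : K := (∑ i, c i) / n with hb
    set c₀ : ZMod n → K := fun i => c i - b
    have hbV : (fun _ => b) ∈ V := by
      have := V.smul_mem b h1
      rwa [show (b • fun _ : ZMod n => (1 : K)) = fun _ => b by ext; simp] at this
    have hc₀ : c₀ ∈ V₀ := by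
      refine ⟨V.sub_mem hcV hbV, mem_sumZero.mpr ?_⟩
      simp only [c₀, Finset.sum_sub_distrib, Finset.sum_const, Finset.card_univ, ZMod.card,
        nsmul_eq_mul, hb]
      field_simp
      simp
    have he : e = deviation (-b) c₀ :=
      deviation_congr (Equiv.refl _) fun i => by
        simp only [c₀, Equiv.refl_apply]
        constructor
        · intro h; rw [h]; ring
        · intro h; linear_combination h
    by_cases hz : c₀ = 0
    · have hb0 : b ≠ 0 := by
        intro h
        refine hc ?_
        ext i
        have := congrFun hz i
        simpa [c₀, h] using this
      rw [he, hz, deviation_ne_zero (neg_ne_zero.mpr hb0)]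
      have : 0 ≤ (q - 1) * (N - 1) * √r :=
        mul_nonneg (mul_nonneg (by linarith) (by linarith)) hs0
      nlinarith
    · by_cases hb0 : b = 0
      · obtain ⟨hN1, h2⟩ := deviation_zero_bound hV₀ hdim2 hnK hcop hs hc₀ hz hcK.symm hN1n
        rw [he, hb0, neg_zero]
        have h3 : N / (q - 1) * deviation 0 c₀ + 1 ≤ (N / (q - 1) - 1) * √r := by
          refine (abs_le_of_sq_le_sq' ?_ (mul_nonneg (by linarith) hs0)).2
          rwa [mul_pow, Real.sq_sqrt hr0, mul_comm _ r]
        have h4 := mul_le_mul_of_nonneg_left h3 (by linarith : 0 ≤ q - 1)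
        have h5 : (q - 1) * (N / (q - 1)) = N := mul_div_cancel₀ _ (by linarith)
        have h6 : N * deviation 0 c₀ + (q - 1) ≤ (N - (q - 1)) * √r := by
          calc _ = (q - 1) * (N / (q - 1) * deviation 0 c₀ + 1) := by
                rw [mul_add, ← mul_assoc, h5, mul_one]
            _ ≤ _ := h4
            _ = ((q - 1) * (N / (q - 1)) - (q - 1)) * √r := by ring
            _ = _ := by rw [h5]
        -- The two coefficients of √r differ by (q-2)N ≥ 0.
        have h7 : (N - (q - 1)) * √r ≤ (q - 1) * (N - 1) * √r := by
          refine mul_le_mul_of_nonneg_right ?_ hs0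
          nlinarith
        linarith
      · obtain ⟨hN1, h2⟩ := deviation_ne_zero_bound hV₀ hdim2 hnK hcop hs hc₀ hz
          (neg_ne_zero.mpr hb0) hcK.symm hNn
        rw [he]
        refine (abs_le_of_sq_le_sq' (h2.trans ?_)
          (mul_nonneg (mul_nonneg (by linarith) (by linarith)) hs0)).2
        rw [mul_pow, Real.sq_sqrt hr0]
        -- The difference of the two sides is (q-2)((q-1)N - q), nonnegative because N ≥ q-1 and q ≥
        -- 3.
        have h3 : N * (q - 1) - 1 ≤ (q - 1) ^ 2 * (N - 1) := by
          have h4 : q ≤ (q - 1) * N := by nlinarith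
          nlinarith [mul_le_mul_of_nonneg_left h4 (by linarith : 0 ≤ q - 2)]
        have h4 := mul_le_mul_of_nonneg_left h3 (mul_nonneg (by linarith : 0 ≤ N - 1) hr0)
        calc _ ≤ _ := h4
          _ = _ := by ring
  have hqN : 0 < q * N := mul_pos (by linarith) (by linarith)
  have haug : augBound (Fintype.card K) n =
      ((q - 1) * (r - 1) - 1 - (q - 1) * (N - 1) * √r) / (q * N) := by
    have hN0 : N ≠ 0 := by linarith
    have hq0 : q ≠ 0 := by linarith
    simp only [augBound, ← hkdef]
    change ((q - 1) * (r - 1) - 1) / (q * N) - (q - 1) / q * ((N - 1) * √r / N) = _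
    field_simp
  rw [haug, div_le_iff₀ hqN, ← hNn]
  rw [hdev] at key
  linarith

end SpectralCodes

/-! ### Transform of the cyclotomic sequence and its zeros -/

section ZeroSets

variable {n : ℕ} [Fact n.Prime] {α : (ZMod n)ˣ} {K L : Type*} [Field K] [Field L] [Algebra K L]
  {η : L}
variable (hn : n ≡ 5 [MOD 8]) (hα : ∀ x, x ∈ Subgroup.zpowers α)

/-- The word of one period of `cycSeq`. -/
def cycWord (α : (ZMod n)ˣ) (ρ : K) (x : ZMod n) : K :=
  if x ∈ cycClass α 4 1 ∪ cycClass α 4 2 ∪ cycClass α 4 3 then 1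
  else if x ∈ cycClass α 4 0 then 0
  else ρ

theorem cycWord_zero (ρ : K) : cycWord α ρ 0 = ρ := by
  have h : ∀ i, (0 : ZMod n) ∉ cycClass α 4 i := fun i h => ne_zero_of_mem_cycClass h rfl
  simp [cycWord, h]

include hn hα in
theorem cycWord_of_mem (ρ : K) {x : ZMod n} {j : ℕ} (hj : j < 4) (hx : x ∈ cycClass α 4 j) :
    cycWord α ρ x = if j = 0 then 0 else 1 := by
  have h : ∀ i < 4, x ∈ cycClass α 4 i ↔ i = j := fun i hi =>
    ⟨fun h => Nat.ModEq.eq_of_lt_of_lt (cycClass_index_modEq hn hα h hx) hi hj, fun h => h ▸ hx⟩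
  simp only [cycWord, Finset.mem_union, h 0 (by norm_num), h 1 (by norm_num), h 2 (by norm_num),
    h 3 (by norm_num)]
  interval_cases j <;> simp

include hn hα in
theorem wdft_cycWord_zero (hη : IsPrimitiveRoot η n) (ρ : K) (hf : (((n - 1) / 4 : ℕ) : K) = 0) :
    wdft hη (cycWord α ρ) 0 = algebraMap K L ρ := by
  rw [wdft_zero, sum_eq_sum_cycClass hn hα, cycWord_zero, Finset.sum_eq_zero, add_zero]
  intro j hj
  rw [Finset.sum_congr rfl fun x hx => cycWord_of_mem hn hα ρ (Finset.mem_range.mp hj) hx,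
    Finset.sum_const, card_cycClass hn hα, nsmul_eq_mul, hf, zero_mul]

include hn hα in
-- Subtracting the all-one word does not change the transform at a ≠ 0, and leaves only -1 on C₀ and
-- ρ - 1 at 0.
theorem wdft_cycWord (hη : IsPrimitiveRoot η n) (ρ : K) {a : ZMod n} {j : ℕ}
    (ha : a ∈ cycClass α 4 j) :
    wdft hη (cycWord α ρ) a = algebraMap K L ρ - 1 - etaSum α η j := by
  have h0 := sum_rootChar hη (ne_zero_of_mem_cycClass ha)
  have h1 : wdft hη (cycWord α ρ) a =
      ∑ i, (algebraMap K L (cycWord α ρ i) - 1) * rootChar hη (a * i) := by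
    simp only [sub_mul, one_mul, Finset.sum_sub_distrib, h0, sub_zero]
    rfl
  have h2 : ∀ j < 4, ∑ x ∈ cycClass α 4 j,
      (algebraMap K L (cycWord α ρ x) - 1) * rootChar hη (a * x) =
        if j = 0 then -∑ x ∈ cycClass α 4 j, rootChar hη (a * x) else 0 := by
    intro j hj
    rw [Finset.sum_congr rfl fun x hx => by rw [cycWord_of_mem hn hα ρ hj hx]]
    by_cases h : j = 0 <;> simp [h]
  rw [h1, sum_eq_sum_cycClass hn hα,
    Finset.sum_congr rfl fun j hj => h2 j (Finset.mem_range.mp hj), cycWord_zero]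
  simp [sum_rootChar_mul hn hα hη ha]
  ring

open Classical in
/-- The exponents of the common zeros of `Λ` and `xⁿ - 1`, if `J` is the set of indices `j` with
`Λ(η^j) = 0` on `C_j`. -/
def zeroSet (α : (ZMod n)ˣ) (ρ : K) (J : Finset ℕ) : Finset (ZMod n) :=
  (if ρ = 0 then {0} else ∅) ∪ J.biUnion (cycClass α 4)

theorem zero_mem_zeroSet {ρ : K} {J : Finset ℕ} : (0 : ZMod n) ∈ zeroSet α ρ J ↔ ρ = 0 := by
  have h : ∀ i, (0 : ZMod n) ∉ cycClass α 4 i := fun i h => ne_zero_of_mem_cycClass h rfl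
  by_cases hρ : ρ = 0 <;> simp [zeroSet, h, hρ]

open Classical in
include hn hα in
theorem mem_zeroSet {ρ : K} {J : Finset ℕ} (hJ : J ⊆ Finset.range 4) {a : ZMod n} {j : ℕ}
    (hj : j < 4) (ha : a ∈ cycClass α 4 j) : a ∈ zeroSet α ρ J ↔ j ∈ J := by
  have h0 := ne_zero_of_mem_cycClass ha
  have h1 : a ∉ (if ρ = 0 then {0} else ∅ : Finset (ZMod n)) := by
    split_ifs <;> simp [h0]
  simp only [zeroSet, Finset.mem_union, h1, false_or, Finset.mem_biUnion]
  constructor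
  · rintro ⟨i, hi, hai⟩
    have := Nat.ModEq.eq_of_lt_of_lt (cycClass_index_modEq hn hα hai ha)
      (Finset.mem_range.mp (hJ hi)) hj
    rwa [← this]
  · exact fun h => ⟨j, h, ha⟩

include hn hα in
theorem wdft_cycWord_eq_zero_iff (hη : IsPrimitiveRoot η n) {ρ : K}
    (hf : (((n - 1) / 4 : ℕ) : K) = 0) {J : Finset ℕ} (hJ : J ⊆ Finset.range 4)
    (h : ∀ j < 4, etaSum α η j = algebraMap K L ρ - 1 ↔ j ∈ J) (a : ZMod n) :
    wdft hη (cycWord α ρ) a = 0 ↔ a ∈ zeroSet α ρ J := by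
  by_cases ha : a = 0
  · rw [ha, wdft_cycWord_zero hn hα hη ρ hf, zero_mem_zeroSet, map_eq_zero]
  · obtain ⟨j, hj, haj⟩ := exists_mem_cycClass hn hα ha
    rw [mem_zeroSet hn hα hJ hj haj, ← h j hj, wdft_cycWord hn hα hη ρ haj, sub_eq_zero, eq_comm]

include hn hα in
theorem pairwiseDisjoint_cycClass {J : Finset ℕ} (hJ : J ⊆ Finset.range 4) :
    (J : Set ℕ).PairwiseDisjoint (cycClass α 4) := fun _ hi _ hj hij =>
  disjoint_cycClass hn hα fun h => hij (Nat.ModEq.eq_of_lt_of_lt h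
    (Finset.mem_range.mp (hJ hi)) (Finset.mem_range.mp (hJ hj)))

theorem disjoint_zeroSet (ρ : K) [Decidable (ρ = 0)] (J : Finset ℕ) :
    Disjoint (if ρ = 0 then {0} else ∅ : Finset (ZMod n)) (J.biUnion (cycClass α 4)) := by
  rw [Finset.disjoint_left]
  intro a ha h
  obtain ⟨j, -, hj⟩ := Finset.mem_biUnion.mp h
  have := ne_zero_of_mem_cycClass hj
  split_ifs at ha <;> simp_all

open Classical in
include hn hα in
theorem card_zeroSet (ρ : K) {J : Finset ℕ} (hJ : J ⊆ Finset.range 4) :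
    (zeroSet α ρ J).card = (if ρ = 0 then 1 else 0) + J.card * ((n - 1) / 4) := by
  rw [zeroSet, Finset.card_union_of_disjoint (disjoint_zeroSet ρ J),
    Finset.card_biUnion (pairwiseDisjoint_cycClass hn hα hJ),
    Finset.sum_congr rfl fun j _ => card_cycClass hn hα j, Finset.sum_const, smul_eq_mul]
  split_ifs <;> simp

open Classical in
include hn hα in
theorem rootProd_zeroSet (ρ : K) {J : Finset ℕ} (hJ : J ⊆ Finset.range 4) :
    rootProd η (zeroSet α ρ J) = (if ρ = 0 then X - 1 else 1) * ∏ j ∈ J, Omega α η j := by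
  rw [zeroSet, rootProd, Finset.prod_union (disjoint_zeroSet ρ J),
    Finset.prod_biUnion (pairwiseDisjoint_cycClass hn hα hJ)]
  congr 1
  split_ifs <;> simp

end ZeroSets

/-! ### Dimension, weight bounds and duadicity for the codes of the sequence -/

section Consequences

variable {n : ℕ} [Fact n.Prime] {α : (ZMod n)ˣ} {K L : Type*} [Field K] [Field L] [Algebra K L]
  {η : L}
variable (hn : n ≡ 5 [MOD 8]) (hα : ∀ x, x ∈ Subgroup.zpowers α) (hη : IsPrimitiveRoot η n)
  (hf : (((n - 1) / 4 : ℕ) : K) = 0)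

include hn hf in
theorem natCast_eq_one : (n : K) = 1 := by
  have h5 : n % 8 = 5 := hn
  have : n = 4 * ((n - 1) / 4) + 1 := by omega
  rw [this, Nat.cast_add, Nat.cast_mul, hf]; simp

include hn hf in
theorem natCast_eq_one' : (n : L) = 1 := by
  rw [← map_natCast (algebraMap K L), natCast_eq_one hn hf, map_one]

open Classical in
include hn hα hη hf in
theorem seqCodeData_cycSeq {ρ : K} {J : Finset ℕ} (hJ : J ⊆ Finset.range 4)
    (h : ∀ j < 4, etaSum α η j = algebraMap K L ρ - 1 ↔ j ∈ J) {f : L[X]} {ℓ : ℕ}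
    (hfac : f = (if ρ = 0 then X - 1 else 1) * ∏ j ∈ J, Omega α η j)
    (hℓ : ℓ = n - ((if ρ = 0 then 1 else 0) + J.card * ((n - 1) / 4))) :
    SeqCodeData n (cycSeq α ρ) ((X ^ n - 1) / f) ℓ := by
  refine seqCodeData_of_zeros hη ?_ _ _ (wdft_cycWord_eq_zero_iff hn hα hη hf hJ h) ?_ ?_
  · rw [natCast_eq_one' hn hf]; exact one_ne_zero
  · rw [rootProd_zeroSet hn hα ρ hJ, hfac]
  · rw [card_zeroSet hn hα ρ hJ, hℓ]

include hn hα hη hf in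
theorem mem_seqCode_cycSeq {ρ : K} {J : Finset ℕ} (hJ : J ⊆ Finset.range 4)
    (h : ∀ j < 4, etaSum α η j = algebraMap K L ρ - 1 ↔ j ∈ J) (c : Fin n → K) :
    c ∈ seqCode n (cycSeq α ρ) ↔ toZMod K n c ∈ specCode K hη (zeroSet α ρ J) :=
  mem_seqCode_iff hη _ _ (wdft_cycWord_eq_zero_iff hn hα hη hf hJ h) c

include hn hα hη hf in
theorem finrank_seqCode_cycSeq {ρ : K} {J : Finset ℕ} (hJ : J ⊆ Finset.range 4)
    (h : ∀ j < 4, etaSum α η j = algebraMap K L ρ - 1 ↔ j ∈ J) :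
    Module.finrank K (seqCode n (cycSeq α ρ)) = (zeroSet α ρ J).card := by
  obtain ⟨-, m, -, -, -, hd⟩ := seqCodeData_cycSeq hn hα hη hf hJ h rfl rfl
  rw [hd, ← card_zeroSet hn hα ρ hJ]
  have : (zeroSet α ρ J).card ≤ n := by
    simpa [ZMod.card] using Finset.card_le_univ (zeroSet α ρ J)
  omega

include hn hα hf in
theorem finrank_specCode {ρ : K} {J : Finset ℕ} (hJ : J ⊆ Finset.range 4)
    (h : ∀ j < 4, etaSum α η j = algebraMap K L ρ - 1 ↔ j ∈ J) :
    Module.finrank K (specCode K hη (zeroSet α ρ J)) = (zeroSet α ρ J).card := by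
  rw [← finrank_seqCode_cycSeq hn hα hη hf hJ h]
  have : seqCode n (cycSeq α ρ) = (specCode K hη (zeroSet α ρ J)).comap (toZMod K n).toLinearMap := by
    ext c
    exact mem_seqCode_cycSeq hn hα hη hf hJ h c
  rw [this]
  exact (Submodule.comap_equiv_eq_map_symm (toZMod K n) _ ▸ (toZMod K n).symm.finrank_map_eq _).symm

open Classical in
include hn hα hf hη in
-- A nonempty zero set makes the code nonzero, so its minimum weight is attained and is not the
-- default infimum 0 of an empty set.
theorem exists_minWeight {ρ : K} {J : Finset ℕ} (hJ : J ⊆ Finset.range 4)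
    (h : ∀ j < 4, etaSum α η j = algebraMap K L ρ - 1 ↔ j ∈ J) (hne : (zeroSet α ρ J).Nonempty) :
    ∃ c ∈ specCode K hη (zeroSet α ρ J), c ≠ 0 ∧
      hammingNorm c = minWeight (seqCode n (cycSeq α ρ)) := by
  have hD : seqCode n (cycSeq α ρ) ≠ ⊥ := by
    intro hb
    have := finrank_seqCode_cycSeq hn hα hη hf hJ h
    rw [hb, finrank_bot] at this
    exact (Finset.card_pos.mpr hne).ne this
  obtain ⟨c, hc, h0, hw⟩ := exists_hammingNorm_eq_minWeight hD
  exact ⟨_, (mem_seqCode_cycSeq hn hα hη hf hJ h c).mp hc, h0, hw⟩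

theorem zeroSet_nonempty {ρ : K} {J : Finset ℕ} (h : ρ = 0 ∨ J.Nonempty) :
    (zeroSet α ρ J).Nonempty := by
  rcases h with h | ⟨j, hj⟩
  · exact ⟨0, zero_mem_zeroSet.mpr h⟩
  · exact ⟨_, Finset.mem_union_right _ (Finset.mem_biUnion.mpr ⟨j, hj, gen_pow_mem j⟩)⟩

include hn hα hη hf in
-- All transforms are supported at 0, so this is the repetition code.
theorem minWeight_eq (h : ∀ j < 4, etaSum α η j ≠ -1) :
    minWeight (seqCode n (cycSeq α (0 : K))) = n := by
  classical
  obtain ⟨c, hc, hc0, hw⟩ := exists_minWeight hn hα hη hf (ρ := (0 : K)) (J := ∅)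
    (Finset.empty_subset _) (by intro j hj; simp [h j hj]) (zeroSet_nonempty (Or.inl rfl))
  rw [← hw]
  have hz : ∀ a : ZMod n, a ≠ 0 → wdft hη c a = 0 := fun a ha => hc a (by simp [zeroSet, ha])
  have hconst : ∀ j, algebraMap K L (c j) = wdft hη c 0 := by
    intro j
    have h1 := sum_dft_mul (rootChar_isPrimitive hη) (fun i => algebraMap K L (c i)) j
    rw [Finset.sum_eq_single 0 (fun a _ ha => by
      
      rw [show dft (rootChar hη) (fun i => algebraMap K L (c i)) a = 0 from hz a ha, zero_mul]) (by simp), natCast_eq_one' hn hf] at h1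
    simpa using h1.symm
  obtain ⟨i₀, hi₀⟩ := Function.ne_iff.mp hc0
  have hall : ∀ j, c j ≠ 0 := fun j hj => hi₀ <| by
    have : algebraMap K L (c i₀) = algebraMap K L (c j) := by rw [hconst, hconst]
    simpa [hj] using (algebraMap K L).injective this
  simp [hammingNorm, hall, ZMod.card]

theorem isSquare_of_mem_cycClass {a : ZMod n} {i : ℕ} (hi : Even i) (ha : a ∈ cycClass α 4 i) :
    IsSquare a := by
  simp only [cycClass, Finset.mem_filter, Finset.mem_univ, true_and] at ha
  obtain ⟨y, hy, rfl⟩ := ha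
  obtain ⟨k, rfl⟩ := Subgroup.mem_zpowers_iff.mp hy
  obtain ⟨t, rfl⟩ := hi
  refine ⟨((α ^ t * (α ^ 2) ^ k : (ZMod n)ˣ) : ZMod n), ?_⟩
  rw [← Units.val_mul]
  congr 1
  rw [mul_mul_mul_comm, ← pow_add, ← mul_zpow, ← pow_add]

include hn hα hη hf in
-- The spectrum of the code lies in C₀ ∪ C₂, the nonzero squares: an even-like quadratic residue
-- code.
theorem sqrt_le_minWeight (h2 : (2 : L) ≠ 0) (h : ∀ j < 4, etaSum α η j = 0 ↔ j = 0 ∨ j = 2) :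
    √(n : ℝ) ≤ minWeight (seqCode n (cycSeq α (1 : K))) := by
  classical
  have hn5 : n % 8 = 5 := hn
  have hJ : ({0, 2} : Finset ℕ) ⊆ Finset.range 4 := by decide
  obtain ⟨c, hc, hc0, hw⟩ := exists_minWeight hn hα hη hf (ρ := (1 : K)) (J := {0, 2})
    hJ (by intro j hj; simp [h j hj])
    (zeroSet_nonempty (Or.inr ⟨0, by simp⟩))
  rw [← hw]
  have hle := le_hammingNorm_sq_of_dft_eq_zero (L := L) (by omega) h2
    (by rw [natCast_eq_one' hn hf]; exact one_ne_zero) (rootChar_isPrimitive hη)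
    (f := fun i => algebraMap K L (c i))
    (fun h0 => hc0 (by
      ext i
      have := congrFun h0 i
      simpa using this)) (fun a ha => hc a (by
        intro hmem
        have ha0 : a ≠ 0 := by
          rintro rfl
          exact one_ne_zero (zero_mem_zeroSet.mp hmem)
        obtain ⟨j, hj, haj⟩ := exists_mem_cycClass hn hα ha0
        rw [mem_zeroSet hn hα hJ hj haj] at hmem
        refine ha.elim ha0 fun hs => hs (isSquare_of_mem_cycClass ?_ haj)
        rcases Finset.mem_insert.mp hmem with rfl | h
        · exact Even.zero
        · rw [Finset.mem_singleton.mp h]; exact even_two))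
  rw [hammingNorm_algebraMap] at hle
  refine Real.sqrt_le_iff.mpr ⟨Nat.cast_nonneg _, ?_⟩
  exact_mod_cast hle

variable [Fintype K]

include hn hα hη hf in
theorem augBound_le_minWeight (hk : 2 ≤ (n - 1) / 4) (hq3 : 3 ≤ Fintype.card K)
    (hord : orderOf (Fintype.card K : ZMod n) = (n - 1) / 4) {i : ℕ} (hi : i < 4)
    (h : ∀ j < 4, etaSum α η j = -1 ↔ j = i) :
    augBound (Fintype.card K) n ≤ minWeight (seqCode n (cycSeq α (0 : K))) := by
  classical
  have hJ : ({i} : Finset ℕ) ⊆ Finset.range 4 := by simpa using hi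
  have hJ' : ∀ j < 4, etaSum α η j = algebraMap K L 0 - 1 ↔ j ∈ ({i} : Finset ℕ) := by
    intro j hj; simp [h j hj]
  obtain ⟨c, hc, hc0, hw⟩ := exists_minWeight hn hα hη hf hJ hJ' (zeroSet_nonempty (Or.inl rfl))
  rw [← hw]
  refine (augBound_le (specCode_isShiftInvariant hη _)
    (const_mem_specCode hη (zero_mem_zeroSet.mpr rfl) 1) ?_ hk ?_ hq3 hord hc hc0)
  · rw [finrank_specCode hn hα hη hf hJ hJ', card_zeroSet hn hα _ hJ]
    simp [add_comm]
  · rw [natCast_eq_one hn hf]; exact one_ne_zero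

include hn hα hη hf in
theorem irrBound_le_minWeight (hk : 2 ≤ (n - 1) / 4)
    (hord : orderOf (Fintype.card K : ZMod n) = (n - 1) / 4) {i : ℕ} (hi : i < 4)
    (h : ∀ j < 4, etaSum α η j = 0 ↔ j = i) :
    irrBound (Fintype.card K) n ≤ minWeight (seqCode n (cycSeq α (1 : K))) := by
  classical
  have hJ : ({i} : Finset ℕ) ⊆ Finset.range 4 := by simpa using hi
  have hJ' : ∀ j < 4, etaSum α η j = algebraMap K L 1 - 1 ↔ j ∈ ({i} : Finset ℕ) := by
    intro j hj; simp [h j hj]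
  obtain ⟨c, hc, hc0, hw⟩ := exists_minWeight hn hα hη hf hJ hJ'
    (zeroSet_nonempty (Or.inr ⟨i, by simp⟩))
  rw [← hw]
  refine (irrBound_le (specCode_isShiftInvariant hη _) ?_ hk ?_ hord
    (fun c hc => sum_eq_zero_of_mem_specCode
      (fun h => one_ne_zero (zero_mem_zeroSet.mp h)) hc) hc hc0)
  · rw [finrank_specCode hn hα hη hf hJ hJ', card_zeroSet hn hα _ hJ]
    simp
  · rw [natCast_eq_one hn hf]; exact one_ne_zero

include hn hα in
theorem neg_mem_cycClass_mod {a : ZMod n} {j : ℕ} (h : a ∈ cycClass α 4 j) :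
    -a ∈ cycClass α 4 ((j + 2) % 4) := by
  rw [cycClass_congr hn hα (Nat.mod_modEq _ _), neg_mem_cycClass_iff hn hα]
  exact h

include hn hα hη hf in
/-- The code with the zeros `C_i`, `i ∉ J`, is duadic if `J` contains exactly one of `j`, `j + 2`,
and satisfies the square root bound. -/
theorem isDuadicCode_seqCode (hq : (Fintype.card K : ZMod n) ∈ cycClass α 4 0) {J : Finset ℕ}
    (hJ : J ⊆ Finset.range 4) (h : ∀ j < 4, etaSum α η j = -1 ↔ j ∈ J)
    (hJ2 : ∀ j < 4, j ∈ J ↔ (j + 2) % 4 ∉ J) :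
    IsDuadicCode η (seqCode n (cycSeq α (0 : K))) ∧
      √(n : ℝ) ≤ minOddWeight (seqCode n (cycSeq α (0 : K))) := by
  classical
  have hJ' : ∀ j < 4, etaSum α η j = algebraMap K L 0 - 1 ↔ j ∈ J := by
    intro j hj; simp [h j hj]
  set Z := zeroSet α (0 : K) J with hZdef
  set T := J.biUnion (cycClass α 4) with hT
  have hZ : ∀ a, a ∈ Z ↔ a = 0 ∨ a ∈ T := by intro a; simp [Z, zeroSet, T]
  have hTmem : ∀ {a : ZMod n} {j : ℕ}, j < 4 → a ∈ cycClass α 4 j → (a ∈ T ↔ j ∈ J) := by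
    intro a j hj ha
    rw [← mem_zeroSet hn hα (ρ := (0 : K)) hJ hj ha, ← hZdef, hZ]
    simp [ne_zero_of_mem_cycClass ha]
  have hT0 : (0 : ZMod n) ∉ T := by
    intro h0
    obtain ⟨j, -, hj⟩ := Finset.mem_biUnion.mp h0
    exact ne_zero_of_mem_cycClass hj rfl
  have hqT : ∀ x, (Fintype.card K : ZMod n) * x ∈ T ↔ x ∈ T := by
    intro x
    simp only [T, Finset.mem_biUnion]
    refine exists_congr fun j => and_congr_right fun _ => ?_
    have := mul_mem_cycClass_iff hn hα (x := x) (i := j) hq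
    rwa [zero_add] at this
  -- Since -1 ∈ C₂, negation moves C_j to C_{j+2}, and J contains exactly one of the two indices. So
  -- -1 serves as the multiplier of the splitting.
  have hnegT : ∀ x : ZMod n, x ≠ 0 → (-x ∈ T ↔ x ∉ T) := by
    intro x hx
    obtain ⟨j, hj, hxj⟩ := exists_mem_cycClass hn hα hx
    rw [hTmem hj hxj, hTmem (Nat.mod_lt _ (by norm_num)) (neg_mem_cycClass_mod hn hα hxj), hJ2 j hj,
      not_not]
  have hq0 := ne_zero_of_mem_cycClass hq
  obtain ⟨m, hm, hmap, hd, hD⟩ := exists_generator hη (cycWord α (0 : K)) Z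
    (wdft_cycWord_eq_zero_iff hn hα hη hf hJ hJ')
  refine ⟨⟨Zᶜ, T, -1, ?_, ?_, ?_, ?_, ?_, ?_, m, ⟨hm, hd, hD⟩, Or.inl hmap⟩, ?_⟩
  · rw [Finset.disjoint_left]
    intro a ha haT
    exact Finset.mem_compl.mp ha ((hZ a).mpr (Or.inr haT))
  · ext a
    by_cases ha : a = 0
    · simp [ha, hZ, hT0]
    · simp only [Finset.mem_union, Finset.mem_compl, hZ, ha, false_or, Finset.mem_erase, ne_eq,
        not_false_eq_true, Finset.mem_univ, and_self, iff_true]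
      exact (em _).symm
  · intro x hx
    rw [Finset.mem_compl, hZ] at hx ⊢
    rwa [hqT, mul_eq_zero, or_iff_right hq0]
  · intro x hx
    rwa [hqT]
  · intro x
    rw [Finset.mem_compl, hZ, Units.val_neg, Units.val_one, neg_one_mul]
    by_cases hx : x = 0
    · simp [hx, hT0]
    · simp [hx, hnegT x hx]
  · intro x
    rw [Finset.mem_compl, hZ, Units.val_neg, Units.val_one, neg_one_mul, neg_eq_zero]
    by_cases hx : x = 0
    · simp [hx, hT0]
    · simp [hx, hnegT x hx]
  · have hmem := mem_seqCode_cycSeq hn hα hη hf hJ hJ'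
    -- The all-one word is odd-like because n = 1 in K, so the infimum is attained.
    have hne : {w : ℕ | ∃ c ∈ seqCode n (cycSeq α (0 : K)), ∑ i, c i ≠ 0 ∧
        hammingNorm c = w}.Nonempty := by
      refine ⟨_, fun _ => 1, (hmem _).mpr (const_mem_specCode hη (zero_mem_zeroSet.mpr rfl) 1), ?_,
        rfl⟩
      simp [natCast_eq_one hn hf]
    obtain ⟨c, hc, hs, hw⟩ := Nat.sInf_mem hne
    have hc' := (hmem c).mp hc
    have hle := le_hammingNorm_sq (rootChar_isPrimitive hη)
      (f := fun i => algebraMap K L (toZMod K n c i)) (by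
        rw [← map_sum, sum_zmod_eq_sum_fin]
        simpa only [toZMod_natCast, ne_eq, map_eq_zero] using hs) (-1) (by
        intro a ha
        by_cases haT : a ∈ T
        · refine Or.inr (hc' _ ?_)
          rw [← hZdef, hZ, Units.val_neg, Units.val_one, neg_one_mul, hnegT a ha]
          simp [ha, haT]
        · refine Or.inl (hc' _ ?_)
          rw [← hZdef, hZ]
          simp [ha, haT])
    have hle' : n ≤ hammingNorm c ^ 2 := by
      rw [← hammingNorm_toZMod, ← hammingNorm_algebraMap (L := L)]
      exact hle
    rw [hw] at hle'
    refine Real.sqrt_le_iff.mpr ⟨Nat.cast_nonneg _, ?_⟩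
    exact_mod_cast hle'

end Consequences

/-! ### Periods in terms of A and B modulo p -/

section Values

variable {n p : ℕ} [Fact n.Prime] {α : (ZMod n)ˣ} {K L : Type*} [Field K] [Field L] [Algebra K L]
  {η : L}
variable (hn : n ≡ 5 [MOD 8]) (hα : ∀ x, x ∈ Subgroup.zpowers α) (hη : IsPrimitiveRoot η n)
  (hf : (((n - 1) / 4 : ℕ) : L) = 0) (hη02 : etaSum α η 0 + etaSum α η 2 = 0)

include hn hα hη hη02 in
theorem etaSum_one_add_three : etaSum α η 1 + etaSum α η 3 = -1 := by
  linear_combination sum_etaSum hn hα hη - hη02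

include hn hα hη hf hη02 in
-- With f = 0 and η_2 = -η_0, the product formula at j = 0 loses its D(1) term.
theorem etaSum_zero_sq : etaSum α η 0 ^ 2 = diffCount α α := by
  have h := etaSum_mul hn hα hη 0
  rw [hf] at h
  simp only [zero_add] at h
  linear_combination etaSum α η 0 * hη02 - h - diffCount α 1 * hη02 -
    diffCount α α * etaSum_one_add_three hn hα hη hη02

include hn hα hη hf hη02 in
-- With η_3 = -1 - η_1, the product formula at j = 1 loses its D(α) term, since η_2 + η_0 = 0.
theorem etaSum_one_sq_add : etaSum α η 1 ^ 2 + etaSum α η 1 = diffCount α 1 := by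
  have h := etaSum_mul hn hα hη 1
  have h13 := etaSum_one_add_three hn hα hη hη02
  rw [hf, show 1 + 3 = 0 + 4 from rfl, etaSum_add_four hn hα, zero_add] at h
  simp only [Nat.reduceAdd] at h
  linear_combination etaSum α η 1 * h13 - h - diffCount α 1 * h13 - diffCount α α * hη02

include hn hα in
-- Gauss' formula gives D(1) and the count of pairs gives D(1) + D(α); in particular both divisions
-- by 16 are exact.
theorem param_eq {u v : ℤ} (huv : (n : ℤ) = u ^ 2 + 4 * v ^ 2) (hu : u ≡ 1 [ZMOD 4]) :
    (3 * (n : ℤ) - 1 + 2 * u) / 16 = ((n - 1) / 4 : ℕ) - diffCount α α ∧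
      (3 * (n : ℤ) + 3 - 2 * u) / 16 = ((n - 1) / 4 : ℕ) - diffCount α 1 := by
  have h5 : n % 8 = 5 := hn
  have h1 := sixteen_mul_diffCount_one_eq hn hα huv hu
  have h2 := one_add_two_mul_diffCount hn hα
  omega

variable [CharP L p]

include hn hα hη hf hη02 in
-- In L the parameters are A = -η_0² and B = -η_1(η_1 + 1).
theorem param_modEq_iff {u v : ℤ} (huv : (n : ℤ) = u ^ 2 + 4 * v ^ 2) (hu : u ≡ 1 [ZMOD 4]) :
    ((3 * (n : ℤ) - 1 + 2 * u) / 16 ≡ 0 [ZMOD p] ↔ etaSum α η 0 = 0) ∧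
    ((3 * (n : ℤ) - 1 + 2 * u) / 16 ≡ p - 1 [ZMOD p] ↔ etaSum α η 0 = 1 ∨ etaSum α η 0 = -1) ∧
    ((3 * (n : ℤ) + 3 - 2 * u) / 16 ≡ 0 [ZMOD p] ↔ etaSum α η 1 = 0 ∨ etaSum α η 1 = -1) := by
  obtain ⟨hA, hB⟩ := param_eq hn hα huv hu
  have h0 := etaSum_zero_sq hn hα hη hf hη02
  have h1 := etaSum_one_sq_add hn hα hη hf hη02
  rw [hA, hB]
  simp only [← CharP.intCast_eq_intCast L p, Int.cast_sub, Int.cast_natCast, hf, zero_sub, ← h0,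
    ← h1, Int.cast_zero, neg_eq_zero, CharP.cast_eq_zero, Int.cast_one, neg_inj]
  refine ⟨sq_eq_zero_iff, sq_eq_one_iff, ?_⟩
  rw [sq, show etaSum α η 1 * etaSum α η 1 + etaSum α η 1 = etaSum α η 1 * (etaSum α η 1 + 1) by ring,
    mul_eq_zero, add_eq_zero_iff_eq_neg]

include hn hα hη hη02 in
-- For ρ = 0 the zeros are the classes with η_j = -1; η_2 and η_3 are eliminated by η_2 = -η_0 and
-- η_3 = -1 - η_1.
theorem etaSum_eq_neg_one_iff {J : Finset ℕ}
    (h : (etaSum α η 0 = -1 ↔ 0 ∈ J) ∧ (etaSum α η 1 = -1 ↔ 1 ∈ J) ∧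
      (etaSum α η 0 = 1 ↔ 2 ∈ J) ∧ (etaSum α η 1 = 0 ↔ 3 ∈ J)) :
    ∀ j < 4, etaSum α η j = -1 ↔ j ∈ J := by
  obtain ⟨h0, h1, h2, h3⟩ := h
  have h13 := etaSum_one_add_three hn hα hη hη02
  intro j hj
  interval_cases j
  · exact h0
  · exact h1
  · rw [← h2, eq_neg_of_add_eq_zero_right hη02, neg_inj]
  · rw [← h3, eq_sub_of_add_eq' h13, sub_eq_self]

include hn hα hη hη02 in
theorem etaSum_eq_zero_iff {J : Finset ℕ}
    (h : (etaSum α η 0 = 0 ↔ 0 ∈ J) ∧ (etaSum α η 1 = 0 ↔ 1 ∈ J) ∧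
      (etaSum α η 0 = 0 ↔ 2 ∈ J) ∧ (etaSum α η 1 = -1 ↔ 3 ∈ J)) :
    ∀ j < 4, etaSum α η j = 0 ↔ j ∈ J := by
  obtain ⟨h0, h1, h2, h3⟩ := h
  have h13 := etaSum_one_add_three hn hα hη hη02
  intro j hj
  interval_cases j
  · exact h0
  · exact h1
  · rw [← h2, eq_neg_of_add_eq_zero_right hη02, neg_eq_zero]
  · rw [← h3, eq_sub_of_add_eq' h13, sub_eq_zero, eq_comm]

end Values

/-! ### The two values of ρ -/

section Data

variable {n : ℕ} [Fact n.Prime] {α : (ZMod n)ˣ} {K L : Type*} [Field K] [Field L] [Algebra K L]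
  {η : L}
variable (hn : n ≡ 5 [MOD 8]) (hα : ∀ x, x ∈ Subgroup.zpowers α) (hη : IsPrimitiveRoot η n)
  (hf : (((n - 1) / 4 : ℕ) : K) = 0)

include hn hα hη hf in
theorem seqCodeData_zero {J : Finset ℕ} (hJ : J ⊆ Finset.range 4)
    (h : ∀ j < 4, etaSum α η j = -1 ↔ j ∈ J) {f : L[X]} {ℓ : ℕ}
    (hfac : f = (X - 1) * ∏ j ∈ J, Omega α η j) (hℓ : ℓ = n - (1 + J.card * ((n - 1) / 4))) :
    SeqCodeData n (cycSeq α (0 : K)) ((X ^ n - 1) / f) ℓ :=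
  seqCodeData_cycSeq hn hα hη hf hJ (by simpa using h) (by simpa using hfac) (by simpa using hℓ)

include hn hα hη hf in
theorem seqCodeData_one {J : Finset ℕ} (hJ : J ⊆ Finset.range 4)
    (h : ∀ j < 4, etaSum α η j = 0 ↔ j ∈ J) {f : L[X]} {ℓ : ℕ}
    (hfac : f = ∏ j ∈ J, Omega α η j) (hℓ : ℓ = n - J.card * ((n - 1) / 4)) :
    SeqCodeData n (cycSeq α (1 : K)) ((X ^ n - 1) / f) ℓ :=
  seqCodeData_cycSeq hn hα hη hf hJ (by simpa using h) (by simpa using hfac) (by simpa using hℓ)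

end Data

end CyclotomicCode

end

/-! ### The six cases -/

open CyclotomicCode in
theorem mainTheorem3 {n p : ℕ} [Fact n.Prime] [Fact p.Prime]
    {K : Type*} [Field K] [Fintype K] [CharP K p]
    {L : Type*} [Field L] [Algebra K L]
    (hn : n ≡ 5 [MOD 8]) (hp : (n - 1) / 4 ≡ 0 [MOD p])
    (α : (ZMod n)ˣ) (hα : ∀ x : (ZMod n)ˣ, x ∈ Subgroup.zpowers α)
    (hq : (Fintype.card K : ZMod n) ∈ CyclotomicCode.cycClass α 4 0)
    (u v : ℤ) (huv : (n : ℤ) = u ^ 2 + 4 * v ^ 2) (hu : u ≡ 1 [ZMOD 4])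
    (η : L) (hη : IsPrimitiveRoot η n)
    (hη02 : CyclotomicCode.etaSum α η 0 + CyclotomicCode.etaSum α η 2 = 0)
    (ρ : K) (hρ : ρ = 0 ∨ ρ = 1) :
    let q : ℕ := Fintype.card K
    let s : ℕ → K := CyclotomicCode.cycSeq α ρ
    let D : Submodule K (Fin n → K) := CyclotomicCode.seqCode n s
    let d : ℕ := CyclotomicCode.minWeight D
    let Ω : ℕ → Polynomial L := CyclotomicCode.Omega α η
    let η₀ : L := CyclotomicCode.etaSum α η 0
    let η₁ : L := CyclotomicCode.etaSum α η 1
    let x : Polynomial L := Polynomial.X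
    let A : ℤ := (3 * (n : ℤ) - 1 + 2 * u) / 16
    let B : ℤ := (3 * (n : ℤ) + 3 - 2 * u) / 16
    -- Case 1
    (A ≡ 0 [ZMOD p] → B ≡ 0 [ZMOD p] →
      (η₁ = 0 ∨ η₁ = -1) ∧
      (η₁ = 0 → ρ = 0 →
        CyclotomicCode.SeqCodeData n s ((x ^ n - 1) / ((x - 1) * Ω 3)) (n - (n + 3) / 4)) ∧
      (η₁ = -1 → ρ = 0 →
        CyclotomicCode.SeqCodeData n s ((x ^ n - 1) / ((x - 1) * Ω 1)) (n - (n + 3) / 4)) ∧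
      (η₁ = 0 → ρ = 1 →
        CyclotomicCode.SeqCodeData n s ((x ^ n - 1) / (Ω 1 * Ω 0 * Ω 2))
          (n - (3 * n - 3) / 4)) ∧
      (η₁ = -1 → ρ = 1 →
        CyclotomicCode.SeqCodeData n s ((x ^ n - 1) / (Ω 3 * Ω 0 * Ω 2))
          (n - (3 * n - 3) / 4)) ∧
      (ρ = 0 → orderOf (q : ZMod n) = (n - 1) / 4 →
        CyclotomicCode.augBound q n ≤ (d : ℝ))) ∧
    -- Case 2
    (A ≡ 0 [ZMOD p] → ¬ B ≡ 0 [ZMOD p] →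
      (ρ = 0 →
        CyclotomicCode.SeqCodeData n s ((x ^ n - 1) / (x - 1)) (n - 1) ∧ d = n) ∧
      (ρ = 1 →
        CyclotomicCode.SeqCodeData n s ((x ^ n - 1) / (Ω 0 * Ω 2)) (n - (n - 1) / 2) ∧
        √(n : ℝ) ≤ (d : ℝ))) ∧
    -- Case 3
    (A ≡ p - 1 [ZMOD p] → B ≡ 0 [ZMOD p] →
      (η₀ = 1 ∨ η₀ = -1) ∧ (η₁ = 0 ∨ η₁ = -1) ∧
      (η₀ = 1 → η₁ = 0 → ρ = 0 →
        CyclotomicCode.SeqCodeData n s ((x ^ n - 1) / ((x - 1) * Ω 3 * Ω 2))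
          (n - (n + 1) / 2)) ∧
      (η₀ = 1 → η₁ = -1 → ρ = 0 →
        CyclotomicCode.SeqCodeData n s ((x ^ n - 1) / ((x - 1) * Ω 1 * Ω 2))
          (n - (n + 1) / 2)) ∧
      (η₀ = -1 → η₁ = 0 → ρ = 0 →
        CyclotomicCode.SeqCodeData n s ((x ^ n - 1) / ((x - 1) * Ω 3 * Ω 0))
          (n - (n + 1) / 2)) ∧
      (η₀ = -1 → η₁ = -1 → ρ = 0 →
        CyclotomicCode.SeqCodeData n s ((x ^ n - 1) / ((x - 1) * Ω 1 * Ω 0))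
          (n - (n + 1) / 2)) ∧
      (η₁ = 0 → ρ = 1 →
        CyclotomicCode.SeqCodeData n s ((x ^ n - 1) / Ω 1) (n - (n - 1) / 4)) ∧
      (η₁ = -1 → ρ = 1 →
        CyclotomicCode.SeqCodeData n s ((x ^ n - 1) / Ω 3) (n - (n - 1) / 4)) ∧
      (ρ = 1 → orderOf (q : ZMod n) = (n - 1) / 4 →
        CyclotomicCode.irrBound q n ≤ (d : ℤ)) ∧
      (ρ = 0 →
        CyclotomicCode.IsDuadicCode η D ∧
        √(n : ℝ) ≤ (CyclotomicCode.minOddWeight D : ℝ))) ∧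
    -- Case 4
    (A ≡ p - 1 [ZMOD p] → ¬ B ≡ 0 [ZMOD p] →
      (η₀ = 1 ∨ η₀ = -1) ∧
      (η₀ = 1 → ρ = 0 →
        CyclotomicCode.SeqCodeData n s ((x ^ n - 1) / ((x - 1) * Ω 2)) (n - (n + 3) / 4)) ∧
      (η₀ = -1 → ρ = 0 →
        CyclotomicCode.SeqCodeData n s ((x ^ n - 1) / ((x - 1) * Ω 0)) (n - (n + 3) / 4)) ∧
      (ρ = 1 → CyclotomicCode.SeqCodeData n s (x ^ n - 1) n) ∧
      (ρ = 0 → orderOf (q : ZMod n) = (n - 1) / 4 →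
        CyclotomicCode.augBound q n ≤ (d : ℝ))) ∧
    -- Case 5
    (¬ A ≡ 0 [ZMOD p] → ¬ A ≡ p - 1 [ZMOD p] → B ≡ 0 [ZMOD p] →
      (η₁ = 0 ∨ η₁ = -1) ∧
      (η₁ = 0 → ρ = 0 →
        CyclotomicCode.SeqCodeData n s ((x ^ n - 1) / ((x - 1) * Ω 3)) (n - (n + 3) / 4)) ∧
      (η₁ = -1 → ρ = 0 →
        CyclotomicCode.SeqCodeData n s ((x ^ n - 1) / ((x - 1) * Ω 1)) (n - (n + 3) / 4)) ∧
      (η₁ = 0 → ρ = 1 →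
        CyclotomicCode.SeqCodeData n s ((x ^ n - 1) / Ω 1) (n - (n - 1) / 4)) ∧
      (η₁ = -1 → ρ = 1 →
        CyclotomicCode.SeqCodeData n s ((x ^ n - 1) / Ω 3) (n - (n - 1) / 4)) ∧
      (ρ = 0 → orderOf (q : ZMod n) = (n - 1) / 4 →
        CyclotomicCode.augBound q n ≤ (d : ℝ)) ∧
      (ρ = 1 → orderOf (q : ZMod n) = (n - 1) / 4 →
        CyclotomicCode.irrBound q n ≤ (d : ℤ))) ∧
    -- Case 6
    (¬ A ≡ 0 [ZMOD p] → ¬ A ≡ p - 1 [ZMOD p] → ¬ B ≡ 0 [ZMOD p] →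
      (ρ = 0 →
        CyclotomicCode.SeqCodeData n s ((x ^ n - 1) / (x - 1)) (n - 1) ∧ d = n) ∧
      (ρ = 1 → CyclotomicCode.SeqCodeData n s (x ^ n - 1) n)) := by
  dsimp only
  have h5 : n % 8 = 5 := hn
  have hpdvd : p ∣ (n - 1) / 4 := (Nat.modEq_zero_iff_dvd).mp hp
  -- For n ≡ 5 (mod 8) the number (n-1)/4 is odd. Hence p ≥ 3, which yields 1 ≠ -1, q ≥ 3 and
  -- (n-1)/4 ≥ 2.
  have hp2 : p ≠ 2 := by
    rintro rfl
    omega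
  have hp3 : 3 ≤ p := by
    have := (Fact.out : p.Prime).two_le
    omega
  have hk : 2 ≤ (n - 1) / 4 := by
    have := Nat.le_of_dvd (by omega) hpdvd
    omega
  have : CharP L p := charP_of_injective_algebraMap (algebraMap K L).injective p
  have hf : (((n - 1) / 4 : ℕ) : K) = 0 := (CharP.cast_eq_zero_iff K p _).mpr hpdvd
  have hfL : (((n - 1) / 4 : ℕ) : L) = 0 := (CharP.cast_eq_zero_iff L p _).mpr hpdvd
  have h2 : (2 : L) ≠ 0 := by
    intro h
    have h' : ((2 : ℕ) : L) = 0 := by exact_mod_cast h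
    have := Nat.le_of_dvd two_pos ((CharP.cast_eq_zero_iff L p 2).mp h')
    omega
  have hq3 : 3 ≤ Fintype.card K :=
    hp3.trans (Nat.le_of_dvd Fintype.card_pos
      ((CharP.cast_eq_zero_iff K p _).mp (FiniteField.cast_card_eq_zero K)))
  have ne1 : ¬ (1 : L) = -1 := fun h => h2 (by linear_combination h)
  have ne2 : ¬ (-1 : L) = 1 := fun h => h2 (by linear_combination -h)
  obtain ⟨hA0, hA1, hB0⟩ := param_modEq_iff (p := p) hn hα hη hfL hη02 huv hu
  rw [hA0, hA1, hB0]
  -- From here on each case only names the set J of indices with η_j = -1 (`m`, for ρ = 0) or η_j =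
  -- 0 (`z`, for ρ = 1).
  have m := fun (J : Finset ℕ) => etaSum_eq_neg_one_iff (J := J) hn hα hη hη02
  have z := fun (J : Finset ℕ) => etaSum_eq_zero_iff (J := J) hn hα hη hη02
  refine ⟨?_, ?_, ?_, ?_, ?_, ?_⟩
  · intro hA hB
    refine ⟨hB, ?_, ?_, ?_, ?_, ?_⟩
    · intro h1 hρ
      subst hρ
      exact seqCodeData_zero hn hα hη hf (J := {3}) (by decide)
        (m {3} (by simp [hA, h1]))
        (by simp) (by rw [Finset.card_singleton]; omega)
    · intro h1 hρ
      subst hρ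
      exact seqCodeData_zero hn hα hη hf (J := {1}) (by decide)
        (m {1} (by simp [hA, h1]))
        (by simp) (by rw [Finset.card_singleton]; omega)
    · intro h1 hρ
      subst hρ
      exact seqCodeData_one hn hα hη hf (J := {1, 0, 2}) (by decide)
        (z {1, 0, 2} (by simp [hA, h1]))
        (by rw [Finset.prod_insert (by decide), Finset.prod_pair (by decide)]; ring) (by rw [show Finset.card ({1, 0, 2} : Finset ℕ) = 3 from rfl]; omega)
    · intro h1 hρ
      subst hρ
      exact seqCodeData_one hn hα hη hf (J := {3, 0, 2}) (by decide)
        (z {3, 0, 2} (by simp [hA, h1]))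
        (by rw [Finset.prod_insert (by decide), Finset.prod_pair (by decide)]; ring) (by rw [show Finset.card ({3, 0, 2} : Finset ℕ) = 3 from rfl]; omega)
    · intro hρ hord
      subst hρ
      rcases hB with h | h
      · exact augBound_le_minWeight hn hα hη hf hk hq3 hord (i := 3) (by norm_num)
          (by simpa only [Finset.mem_singleton] using
            (m {3} (by simp [hA, h])))
      · exact augBound_le_minWeight hn hα hη hf hk hq3 hord (i := 1) (by norm_num)
          (by simpa only [Finset.mem_singleton] using
            (m {1} (by simp [hA, h])))
  · intro hA hB
    rw [not_or] at hB
    refine ⟨?_, ?_⟩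
    · intro hρ
      subst hρ
      have hm := (m ∅ (by simp [hA, hB]))
      refine ⟨seqCodeData_zero hn hα hη hf (J := ∅) (by decide) hm (by simp) (by simp), ?_⟩
      exact minWeight_eq hn hα hη hf fun j hj h => Finset.notMem_empty j ((hm j hj).mp h)
    · intro hρ
      subst hρ
      have hz := (z {0, 2} (by simp [hA, hB]))
      refine ⟨seqCodeData_one hn hα hη hf (J := {0, 2}) (by decide) hz
        (by rw [Finset.prod_pair (by decide)])
        (by rw [Finset.card_pair (by decide)]; omega), ?_⟩
      exact sqrt_le_minWeight hn hα hη hf h2 (by simpa only [Finset.mem_insert, Finset.mem_singleton] using hz)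
  · intro hA hB
    have hA' : ¬ etaSum α η 0 = 0 := by rcases hA with h | h <;> simp [h]
    refine ⟨hA, hB, ?_, ?_, ?_, ?_, ?_, ?_, ?_, ?_⟩
    · intro h0 h1 hρ
      subst hρ
      exact seqCodeData_zero hn hα hη hf (J := {3, 2}) (by decide)
        (m {3, 2} (by simp [h0, h1, ne1]))
        (by rw [Finset.prod_pair (by decide)]; ring) (by rw [Finset.card_pair (by decide)]; omega)
    · intro h0 h1 hρ
      subst hρ
      exact seqCodeData_zero hn hα hη hf (J := {1, 2}) (by decide)
        (m {1, 2} (by simp [h0, h1, ne1]))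
        (by rw [Finset.prod_pair (by decide)]; ring) (by rw [Finset.card_pair (by decide)]; omega)
    · intro h0 h1 hρ
      subst hρ
      exact seqCodeData_zero hn hα hη hf (J := {3, 0}) (by decide)
        (m {3, 0} (by simp [h0, h1, ne2]))
        (by rw [Finset.prod_pair (by decide)]; ring) (by rw [Finset.card_pair (by decide)]; omega)
    · intro h0 h1 hρ
      subst hρ
      exact seqCodeData_zero hn hα hη hf (J := {1, 0}) (by decide)
        (m {1, 0} (by simp [h0, h1, ne2]))
        (by rw [Finset.prod_pair (by decide)]; ring) (by rw [Finset.card_pair (by decide)]; omega)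
    · intro h1 hρ
      subst hρ
      exact seqCodeData_one hn hα hη hf (J := {1}) (by decide)
        (z {1} (by simp [hA', h1]))
        (by simp) (by rw [Finset.card_singleton]; omega)
    · intro h1 hρ
      subst hρ
      exact seqCodeData_one hn hα hη hf (J := {3}) (by decide)
        (z {3} (by simp [hA', h1]))
        (by simp) (by rw [Finset.card_singleton]; omega)
    · intro hρ hord
      subst hρ
      rcases hB with h | h
      · exact irrBound_le_minWeight hn hα hη hf hk hord (i := 1) (by norm_num)
          (by simpa only [Finset.mem_singleton] using
            (z {1} (by simp [hA', h])))
      · exact irrBound_le_minWeight hn hα hη hf hk hord (i := 3) (by norm_num)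
          (by simpa only [Finset.mem_singleton] using
            (z {3} (by simp [hA', h])))
    · intro hρ
      subst hρ
      rcases hA with h0 | h0 <;> rcases hB with h1 | h1
      · exact isDuadicCode_seqCode hn hα hη hf hq (J := {3, 2}) (by decide)
          (m {3, 2} (by simp [h0, h1, ne1])) (by decide)
      · exact isDuadicCode_seqCode hn hα hη hf hq (J := {1, 2}) (by decide)
          (m {1, 2} (by simp [h0, h1, ne1])) (by decide)
      · exact isDuadicCode_seqCode hn hα hη hf hq (J := {3, 0}) (by decide)
          (m {3, 0} (by simp [h0, h1, ne2])) (by decide)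
      · exact isDuadicCode_seqCode hn hα hη hf hq (J := {1, 0}) (by decide)
          (m {1, 0} (by simp [h0, h1, ne2])) (by decide)
  · intro hA hB
    rw [not_or] at hB
    have hA' : ¬ etaSum α η 0 = 0 := by rcases hA with h | h <;> simp [h]
    refine ⟨hA, ?_, ?_, ?_, ?_⟩
    · intro h0 hρ
      subst hρ
      exact seqCodeData_zero hn hα hη hf (J := {2}) (by decide)
        (m {2} (by simp [h0, hB, ne1]))
        (by simp) (by rw [Finset.card_singleton]; omega)
    · intro h0 hρ
      subst hρ
      exact seqCodeData_zero hn hα hη hf (J := {0}) (by decide)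
        (m {0} (by simp [h0, hB, ne2]))
        (by simp) (by rw [Finset.card_singleton]; omega)
    · intro hρ
      subst hρ
      have hd := seqCodeData_one (L := L) (f := 1) (ℓ := n) hn hα hη hf (J := ∅) (by decide)
        (z ∅ (by simp [hA', hB]))
        (by simp) (by simp)
      rwa [EuclideanDomain.div_one] at hd
    · intro hρ hord
      subst hρ
      rcases hA with h | h
      · exact augBound_le_minWeight hn hα hη hf hk hq3 hord (i := 2) (by norm_num)
          (by simpa only [Finset.mem_singleton] using
            (m {2} (by simp [hB, ne1, h])))
      · exact augBound_le_minWeight hn hα hη hf hk hq3 hord (i := 0) (by norm_num)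
          (by simpa only [Finset.mem_singleton] using
            (m {0} (by simp [hB, ne2, h])))
  · intro hA hA1' hB
    rw [not_or] at hA1'
    refine ⟨hB, ?_, ?_, ?_, ?_, ?_, ?_⟩
    · intro h1 hρ
      subst hρ
      exact seqCodeData_zero hn hα hη hf (J := {3}) (by decide)
        (m {3} (by simp [hA1', h1]))
        (by simp) (by rw [Finset.card_singleton]; omega)
    · intro h1 hρ
      subst hρ
      exact seqCodeData_zero hn hα hη hf (J := {1}) (by decide)
        (m {1} (by simp [hA1', h1]))
        (by simp) (by rw [Finset.card_singleton]; omega)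
    · intro h1 hρ
      subst hρ
      exact seqCodeData_one hn hα hη hf (J := {1}) (by decide)
        (z {1} (by simp [hA, h1]))
        (by simp) (by rw [Finset.card_singleton]; omega)
    · intro h1 hρ
      subst hρ
      exact seqCodeData_one hn hα hη hf (J := {3}) (by decide)
        (z {3} (by simp [hA, h1]))
        (by simp) (by rw [Finset.card_singleton]; omega)
    · intro hρ hord
      subst hρ
      rcases hB with h | h
      · exact augBound_le_minWeight hn hα hη hf hk hq3 hord (i := 3) (by norm_num)
          (by simpa only [Finset.mem_singleton] using
            (m {3} (by simp [hA1', h])))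
      · exact augBound_le_minWeight hn hα hη hf hk hq3 hord (i := 1) (by norm_num)
          (by simpa only [Finset.mem_singleton] using
            (m {1} (by simp [hA1', h])))
    · intro hρ hord
      subst hρ
      rcases hB with h | h
      · exact irrBound_le_minWeight hn hα hη hf hk hord (i := 1) (by norm_num)
          (by simpa only [Finset.mem_singleton] using
            (z {1} (by simp [hA, h])))
      · exact irrBound_le_minWeight hn hα hη hf hk hord (i := 3) (by norm_num)
          (by simpa only [Finset.mem_singleton] using
            (z {3} (by simp [hA, h])))
  · intro hA hA1' hB
    rw [not_or] at hA1' hB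
    refine ⟨?_, ?_⟩
    · intro hρ
      subst hρ
      have hm := (m ∅ (by simp [hA1', hB]))
      refine ⟨seqCodeData_zero hn hα hη hf (J := ∅) (by decide) hm (by simp) (by simp), ?_⟩
      exact minWeight_eq hn hα hη hf fun j hj h => Finset.notMem_empty j ((hm j hj).mp h)
    · intro hρ
      subst hρ
      have hd := seqCodeData_one (L := L) (f := 1) (ℓ := n) hn hα hη hf (J := ∅) (by decide)
        (z ∅ (by simp [hA, hB]))
        (by simp) (by simp)
      rwa [EuclideanDomain.div_one] at hd
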